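/- **Setting.** Let $f:\mathbb R_{\ge 0}^n\to\mathbb R_{\ge 0}$ be convex, monotone and differentiable with $f(\mathbf 0)=0$ and with monotone gradient ($x\le y$ implies $\nabla f(x)\le\nabla f(y)$ coordinatewise), such that $p:=\sup_{x\ge \mathbf 0}\frac{\langle x,\nabla f(x)\rangle}{f(x)}$ is finite (with $0/0:=0$). In the online covering problem the rows $A_1,\dots,A_m$ of a matrix $A=(a_{tj})\in\mathbb R_{\ge0}^{m\times n}$ arrive one by one, where $Ax\ge\mathbf 1$ has a solution $x\ge\mathbf 0$. After each arrival the solution $x$, which starts at $\mathbf 0$, must be increased coordinatewise so that $A_t x\ge 1$. Let $\mathsf{OPT}=\inf\{f(x): x\ge\mathbf 0,\ Ax\ge\mathbf 1\}$, and let $d=\max_t|\{j:a_{tj}>0\}|$ be the row sparsity. The objective $f$, the number $d$, an arbitrary advice $x'\in\mathbb R^n_{\ge0}$ and a confidence parameter $\lambda\in[0,1]$ are given in advance. **Algorithm (continuous primal-dual learning-augmented algorithm).** In round $t$, while $A_tx<1$, increase every $x_j$ with $a_{tj}>0$ continuously at rate $$\frac{\partial x_j}{\partial\tau}=\frac{a_{tj}}{\nabla_jf(x)}\bigl(x_j+D_j\bigr),\qquad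 D_j=\begin{cases}\dfrac{\lambda}{a_{tj}d}+\dfrac{(1-\lambda)\,x'_j\mathbf 1_{x_j<x'_j}}{A_tx'_c}&\text{if }A_tx'\ge1,\\[2ex]\dfrac1{a_{tj}d}&\text{if }A_tx'<1,\end{cases}$$ where $x'_c$ is $x'$ restricted to the coordinates $j$ with $x_j<x'_j$ (at the current time). The equation is required at all but finitely many times of a round, in the form multiplied by $\nabla_jf(x)$. If the row contains variables for which $\nabla_jf$ vanishes identically (infinite rate), then only such variables are raised, at once, until $A_tx=1$. **Theorem.** There are an absolute constant $C>0$ and a constant $K(p)$ depending only on $p$ such that the following holds for all $n,f,x',\lambda,d$ as above. The algorithm can be carried out online on all instances of row sparsity $d$. In every execution the solution is non-decreasing, after each round it satisfies the constraint that has just arrived, and the final solution $\bar x$ satisfies $A\bar x\ge\mathbf 1$. Moreover, with $\hat d=\max\{d,2\}$: 1. if $\lambda<1$, then $f(\bar x)\le \frac{K(p)}{1-\lambda}f(x')+(C\,p\log \hat d)^p\cdot\mathsf{OPT}$; 2. if $\lambda>0$, then $f(\bar x)\le \bigl(C\,p\log\frac{\hat d}{\lambda}\bigr)^p\cdot\mathsf{OPT}$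 (so that for $0<\lambda<1$ the value $f(\bar x)$ is at most the minimum of the two bounds); 3. if $\lambda<1$ and $x'$ is feasible, i.e. $Ax'\ge\mathbf 1$, then $f(\bar x)\le\frac{K(p)}{1-\lambda}f(x')$. -/

import Mathlib

open Matrix

/-- The gradient of `f` on the closed nonnegative orthant `Set.Ici 0` of `ℝⁿ`
(one-sided at boundary points): its `j`-th entry is the partial derivative `∇_j f (x)`. -/
noncomputable def orthantGrad {n : ℕ} (f : (Fin n → ℝ) → ℝ) (x : Fin n → ℝ) : Fin n → ℝ :=
  fun j => fderivWithin ℝ f (Set.Ici 0) x (Pi.single j 1)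

/-- The objectives of online convex covering: convex, monotone, differentiable functions on the
nonnegative orthant which vanish at `0` and have a monotone gradient. -/
structure IsCoveringObjective {n : ℕ} (f : (Fin n → ℝ) → ℝ) : Prop where
  convex : ConvexOn ℝ (Set.Ici 0) f
  mono : MonotoneOn f (Set.Ici 0)
  diff : DifferentiableOn ℝ f (Set.Ici 0)
  map_zero : f 0 = 0
  grad_mono : MonotoneOn (orthantGrad f) (Set.Ici 0)

/-- `p = sup_{x ≥ 0} ⟨x, ∇f(x)⟩ / f(x)`, a finite supremum.  A zero of `f` in the orthant is also
a zero of `⟨x, ∇f(x)⟩`; the quotient is then read as `0`. -/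
def IsGrowthExponent {n : ℕ} (f : (Fin n → ℝ) → ℝ) (p : ℝ) : Prop :=
  IsLUB {r : ℝ | ∃ x : Fin n → ℝ, 0 ≤ x ∧ r = (x ⬝ᵥ orthantGrad f x) / f x} p

/-- `x` is a feasible solution of the covering program `A x ≥ 1`, `x ≥ 0`. -/
def IsCover {m n : ℕ} (A : Matrix (Fin m) (Fin n) ℝ) (x : Fin n → ℝ) : Prop :=
  0 ≤ x ∧ ∀ i, 1 ≤ A i ⬝ᵥ x

/-- Constraint matrices: nonnegative entries, and the covering program is feasible. -/
def IsCoveringMatrix {m n : ℕ} (A : Matrix (Fin m) (Fin n) ℝ) : Prop :=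
  (∀ i j, 0 ≤ A i j) ∧ ∃ x, IsCover A x

/-- Row sparsity: the largest number of positive entries in a row. -/
noncomputable def rowSparsity {m n : ℕ} (A : Matrix (Fin m) (Fin n) ℝ) : ℕ :=
  Finset.univ.sup fun i => (Finset.univ.filter fun j => 0 < A i j).card

/-- The optimal offline value. -/
noncomputable def coveringOPT {m n : ℕ} (f : (Fin n → ℝ) → ℝ) (A : Matrix (Fin m) (Fin n) ℝ) : ℝ :=
  sInf (f '' {x | IsCover A x})

/-- The advice `x'` restricted to the coordinates in which `x` has not reached it yet. -/
noncomputable def adviceLeft {n : ℕ} (x' x : Fin n → ℝ) : Fin n → ℝ :=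
  fun j => if x j < x' j then x' j else 0

/-- The additive term `D_j` in the growth rate of `x_j` while the constraint with row `a` is
being processed and the current solution is `x`. -/
noncomputable def growthTerm {n : ℕ} (d : ℕ) (lam : ℝ) (x' a x : Fin n → ℝ) (j : Fin n) : ℝ :=
  open Classical in
  if 1 ≤ a ⬝ᵥ x' then
    lam / (a j * d) + (1 - lam) * adviceLeft x' x j / (a ⬝ᵥ adviceLeft x' x)
  else 1 / (a j * d)

/-- The while loop for the row `a`, started at `u` and run for time `T`, follows the continuous
path `X`: it stops at the first time at which the constraint is satisfied, the variables outside
the row stay fixed, and the variables in the row grow at rate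
`dx_j/dτ = a_j (x_j + D_j) / ∇_j f(x)`, except at finitely many times (the `D_j` jump when a
variable reaches the advice).  The equation is multiplied by `∇_j f(x)`, which may vanish
while `x_j = 0`, for instance at the start. -/
structure IsGrowthPath {n : ℕ} (f : (Fin n → ℝ) → ℝ) (d : ℕ) (lam : ℝ) (x' a u : Fin n → ℝ)
    (T : ℝ) (X : ℝ → Fin n → ℝ) : Prop where
  pos : 0 < T
  start : X 0 = u
  cont : ContinuousOn X (Set.Icc 0 T)
  nonneg : ∀ τ ∈ Set.Icc 0 T, 0 ≤ X τ
  unsat : ∀ τ ∈ Set.Ico 0 T, a ⬝ᵥ X τ < 1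
  final : 1 ≤ a ⬝ᵥ X T
  fixed : ∀ τ ∈ Set.Icc 0 T, ∀ j, a j = 0 → X τ j = u j
  rate : ∃ S : Set ℝ, S.Finite ∧ ∀ τ ∈ Set.Ioo 0 T, τ ∉ S → ∀ j, 0 < a j →
    ∃ v : ℝ, HasDerivAt (fun s => X s j) v τ ∧
      orthantGrad f (X τ) j * v = a j * (X τ j + growthTerm d lam x' a (X τ) j)

/-- A variable on which the objective does not depend: its partial derivative is identically
`0`, so that its growth rate is infinite. -/
def IsFree {n : ℕ} (f : (Fin n → ℝ) → ℝ) (j : Fin n) : Prop :=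
  ∀ x : Fin n → ℝ, 0 ≤ x → orthantGrad f x j = 0

/-- One round (row `a`) of the primal update of the continuous primal-dual learning-augmented
algorithm, from the solution `u` to the solution given by the last argument. -/
inductive PDLARound {n : ℕ} (f : (Fin n → ℝ) → ℝ) (d : ℕ) (lam : ℝ) (x' a u : Fin n → ℝ) :
    (Fin n → ℝ) → Prop
  /-- The constraint already holds: nothing happens. -/
  | satisfied (h : 1 ≤ a ⬝ᵥ u) : PDLARound f d lam x' a u u
  /-- No variable of the row is free: the variables grow until the constraint holds. -/
  | grow (h : a ⬝ᵥ u < 1) (hfree : ∀ j, 0 < a j → ¬ IsFree f j) (T : ℝ) (X : ℝ → Fin n → ℝ)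
      (hX : IsGrowthPath f d lam x' a u T X) : PDLARound f d lam x' a u (X T)
  /-- Some variables of the row are free (infinite rate): these, and only these, are raised at
  once until the constraint holds. -/
  | jump (h : a ⬝ᵥ u < 1) (hfree : ∃ j, 0 < a j ∧ IsFree f j) (v : Fin n → ℝ) (huv : u ≤ v)
      (hfix : ∀ j, ¬ (0 < a j ∧ IsFree f j) → v j = u j) (hv : a ⬝ᵥ v = 1) :
      PDLARound f d lam x' a u v

/-- `x 0 = 0, x 1, …, x m` are the solutions after the successive rounds of an execution of the
algorithm on the rows of `A`, with advice `x'` and confidence parameter `lam`. -/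
def IsPDLARun {m n : ℕ} (f : (Fin n → ℝ) → ℝ) (d : ℕ) (lam : ℝ) (x' : Fin n → ℝ)
    (A : Matrix (Fin m) (Fin n) ℝ) (x : Fin (m + 1) → Fin n → ℝ) : Prop :=
  x 0 = 0 ∧ ∀ i : Fin m, PDLARound f d lam x' (A i) (x i.castSucc) (x i.succ)

/-- An online algorithm: the current solution is a function of the rows revealed so far. -/
abbrev OnlineAlgorithm (n : ℕ) : Type := List (Fin n → ℝ) → (Fin n → ℝ)

/-- The solutions which an online algorithm produces after `0, 1, …, m` rows of `A`. -/
def OnlineAlgorithm.run {m n : ℕ} (alg : OnlineAlgorithm n) (A : Matrix (Fin m) (Fin n) ℝ) :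
    Fin (m + 1) → Fin n → ℝ :=
  fun k => alg ((List.ofFn fun i => A i).take k)

section

open Set Filter Topology

/-! The analysis is a potential argument in which the running time of the loop serves as the dual
variable. Along a round `df/dτ = a·x + ∑ a_j D_j ≤ 2`, so the final value `f(x̄)` is at most twice
the total time `∑ y_i`. To bound the time, fix a target `w ≥ 0`, put `g = ∇f(x̄)` and follow `Φ_w(x)
= ∑ g_j w_j log((x_j + δ w_j)/(x_j + N w_j))`. It never rises by more than `log(N/δ) ⟨w, g⟩` in
total (`coveringPotential_sub_le`). Since the gradient is monotone, `∇_j f(x) ≤ g_j` throughout, and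
the growth equation makes `Φ_w` increase at least at the speed `potentialRate`.

Two estimates carry the proof. If `w` satisfies the current row and every `D_j` is at least `μ/(a_j
d)`, the speed is at least `1/4` for `δ = μ/d`, `N = 4d` (`le_potentialRate_of_cover`). If the
advice satisfies the row, the speed for `w = x'`, `δ = 1 - λ`, `N = 4` is at least `1/8`
(`le_potentialRate_of_advice`). Charging rows to one or both targets yields bounds `f(x̄) ≤ Q ⟨w,
∇f(x̄)⟩`. Convexity, tested at the point `Qp·w`, together with `f(s w) ≤ s^p f(w)`, turns such a
bound into `f(x̄) ≤ (Qp)^p f(w)` (`le_rpow_mul_of_le_dotProduct_grad`). For the advice, `Q` is of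
order `log(4/(1-λ))`, and its `p`-th power is absorbed into `K(p)/(1-λ)`.

That the algorithm can be executed is a separate matter: the vector field may blow up where `x_j =
0` and jumps where `x_j = x'_j`. A path is obtained as an ultralimit of Euler schemes started
slightly above `u` (`IsGrowthField.exists_path`). Moving coordinates grow at a speed bounded below,
so each crosses its advice value at most once, which leaves only finitely many exceptional times. -/

theorem clm_apply_eq_dotProduct {n : ℕ} (L : (Fin n → ℝ) →L[ℝ] ℝ) (v : Fin n → ℝ) :
    L v = v ⬝ᵥ fun j => L (Pi.single j 1) := by
  refine (LinearMap.pi_apply_eq_sum_univ L.toLinearMap v).trans (Finset.sum_congr rfl fun i _ => ?_)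
  have : (fun j => if i = j then (1 : ℝ) else 0) = Pi.single i 1 := by
    ext j; simp [Pi.single_apply, eq_comm]
  rw [this]
  rfl

/-! ### Convexity, growth and gradient of the objective -/

namespace IsCoveringObjective

variable {n : ℕ} {f : (Fin n → ℝ) → ℝ}

theorem hasDerivWithinAt_comp (hf : IsCoveringObjective f) {γ : ℝ → Fin n → ℝ} {s : Set ℝ} {t : ℝ}
    {v : Fin n → ℝ} (hγ : ∀ j, HasDerivWithinAt (fun r => γ r j) (v j) s t)
    (hs : ∀ r ∈ s, 0 ≤ γ r) (ht : t ∈ s) :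
    HasDerivWithinAt (fun r => f (γ r)) (v ⬝ᵥ orthantGrad f (γ t)) s t := by
  have h1 : HasFDerivWithinAt f (fderivWithin ℝ f (Ici 0) (γ t)) (Ici 0) (γ t) :=
    (hf.diff (γ t) (hs t ht)).hasFDerivWithinAt
  have h2 := h1.comp_hasDerivWithinAt t (hasDerivWithinAt_pi.2 hγ) hs
  rw [clm_apply_eq_dotProduct] at h2
  exact h2

theorem add_grad_le (hf : IsCoveringObjective f) {x y : Fin n → ℝ} (hx : 0 ≤ x) (hy : 0 ≤ y) :
    f x + (y - x) ⬝ᵥ orthantGrad f x ≤ f y := by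
  have hseg : ∀ r ∈ Icc (0 : ℝ) 1, (0 : Fin n → ℝ) ≤ AffineMap.lineMap x y r := by
    intro r hr
    have h : AffineMap.lineMap x y r ∈ segment ℝ x y := by
      rw [segment_eq_image_lineMap]; exact mem_image_of_mem _ hr
    exact (convex_Ici (𝕜 := ℝ) (0 : Fin n → ℝ)).segment_subset hx hy h
  have hconv : ConvexOn ℝ (Icc (0 : ℝ) 1) (fun r => f (AffineMap.lineMap x y r)) :=
    (hf.convex.comp_affineMap (AffineMap.lineMap x y)).subset hseg (convex_Icc 0 1)
  have hd : HasDerivWithinAt (fun r => f (AffineMap.lineMap x y r))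
      ((y - x) ⬝ᵥ orthantGrad f (AffineMap.lineMap x y (0 : ℝ))) (Icc 0 1) (0 : ℝ) := by
    refine hf.hasDerivWithinAt_comp (fun j => ?_) hseg (by simp)
    have : HasDerivAt (fun r : ℝ => r * (y j - x j) + x j) (1 * (y j - x j)) 0 :=
      ((hasDerivAt_id _).mul_const _).add_const _
    simpa [AffineMap.lineMap_apply] using this.hasDerivWithinAt
  have := hconv.le_slope_of_hasDerivWithinAt (x := 0) (y := 1) (by simp) (by simp) one_pos hd
  simp [slope_def_field] at this
  rw [sub_dotProduct]
  linarith

theorem nonneg (hf : IsCoveringObjective f) {x : Fin n → ℝ} (hx : 0 ≤ x) : 0 ≤ f x := by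
  rw [← hf.map_zero]
  exact hf.mono (mem_Ici.2 le_rfl) hx hx

theorem add_single_nonneg {x : Fin n → ℝ} (hx : 0 ≤ x) (j : Fin n) {s : ℝ} (hs : 0 ≤ s) :
    0 ≤ x + s • Pi.single j (1 : ℝ) :=
  add_nonneg hx (smul_nonneg hs (Pi.single_nonneg.2 zero_le_one))

theorem mul_grad_le (hf : IsCoveringObjective f) {x : Fin n → ℝ} (hx : 0 ≤ x) (j : Fin n) {s : ℝ}
    (hs : 0 ≤ x + s • Pi.single j (1 : ℝ)) :
    f x + s * orthantGrad f x j ≤ f (x + s • Pi.single j 1) := by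
  have := hf.add_grad_le hx hs
  simpa using this

theorem grad_nonneg (hf : IsCoveringObjective f) {x : Fin n → ℝ} (hx : 0 ≤ x) (j : Fin n) :
    0 ≤ orthantGrad f x j := by
  have hs : ∀ r ∈ Ici (0 : ℝ), 0 ≤ x + r • Pi.single j (1 : ℝ) := fun r hr =>
    add_single_nonneg hx j hr
  have hd : HasDerivWithinAt (fun r : ℝ => f (x + r • Pi.single j 1))
      ((Pi.single j 1) ⬝ᵥ orthantGrad f (x + (0 : ℝ) • Pi.single j 1)) (Ici 0) 0 := by
    refine hf.hasDerivWithinAt_comp (fun i => ?_) hs (by simp)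
    have : HasDerivAt (fun r : ℝ => x i + r * (Pi.single j 1 : Fin n → ℝ) i)
      (1 * (Pi.single j 1 : Fin n → ℝ) i) 0 := ((hasDerivAt_id _).mul_const _).const_add _
    simpa using this.hasDerivWithinAt
  have hm : MonotoneOn (fun r : ℝ => f (x + r • Pi.single j 1)) (Ici 0) := by
    intro r hr r' hr' h
    refine hf.mono (hs r hr) (hs r' hr') (add_le_add le_rfl ?_)
    exact smul_le_smul_of_nonneg_right h (Pi.single_nonneg.2 zero_le_one)
  have := hd.nonneg_of_monotoneOn
    ((uniqueDiffWithinAt_iff_accPt.1 (uniqueDiffOn_Ici (0 : ℝ) 0 self_mem_Ici))) hm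
  simpa using this

/-- Where `f x > 0` this is the definition of `p`. Where `f x = 0` the quotient carries no
information, but monotonicity makes `f` vanish on the segment from `0` to `x`, so its derivative
along that segment is `0`. -/
theorem dotProduct_grad_le (hf : IsCoveringObjective f) {p : ℝ} (hp : IsGrowthExponent f p)
    {x : Fin n → ℝ} (hx : 0 ≤ x) : x ⬝ᵥ orthantGrad f x ≤ p * f x := by
  rcases (hf.nonneg hx).lt_or_eq with h | h
  · rw [← div_le_iff₀ h]
    exact hp.1 ⟨x, hx, rfl⟩
  · have hs : ∀ r ∈ Icc (0 : ℝ) 1, 0 ≤ r • x := fun r hr => smul_nonneg hr.1 hx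
    have hd : HasDerivWithinAt (fun r : ℝ => f (r • x))
        (x ⬝ᵥ orthantGrad f ((1 : ℝ) • x)) (Icc 0 1) 1 := by
      refine hf.hasDerivWithinAt_comp (fun i => ?_) hs (by simp)
      have : HasDerivAt (fun r : ℝ => r * x i) (1 * x i) 1 := (hasDerivAt_id _).mul_const _
      simpa using this.hasDerivWithinAt
    have hc : HasDerivWithinAt (fun r : ℝ => f (r • x)) 0 (Icc 0 1) 1 := by
      refine (hasDerivWithinAt_const (1 : ℝ) (Icc 0 1) (0 : ℝ)).congr (fun r hr => ?_) (by simp [h])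
      refine le_antisymm ?_ (hf.nonneg (hs r hr))
      rw [h]
      refine hf.mono (hs r hr) hx fun i => ?_
      simpa using mul_le_mul_of_nonneg_right hr.2 (hx i)
    have := (uniqueDiffOn_Icc zero_lt_one (1 : ℝ) (by simp)).eq_deriv _ hd hc
    rw [one_smul] at this
    rw [this, ← h, mul_zero]

theorem le_dotProduct_grad (hf : IsCoveringObjective f) {x : Fin n → ℝ} (hx : 0 ≤ x) :
    f x ≤ x ⬝ᵥ orthantGrad f x := by
  have := hf.add_grad_le hx le_rfl
  rw [hf.map_zero, zero_sub, neg_dotProduct] at this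
  linarith

/-- Convexity with `f 0 = 0` gives `f x ≤ ⟨x, ∇f x⟩ ≤ p f x`, so one positive value of `f` forces `1
≤ p`. -/
theorem eq_zero_or_one_le (hf : IsCoveringObjective f) {p : ℝ} (hp : IsGrowthExponent f p) :
    (∀ x, 0 ≤ x → f x = 0) ∨ 1 ≤ p := by
  by_cases h : ∃ x, 0 ≤ x ∧ 0 < f x
  · obtain ⟨x, hx, hfx⟩ := h
    refine Or.inr ?_
    have := (hf.le_dotProduct_grad hx).trans (hf.dotProduct_grad_le hp hx)
    exact le_of_mul_le_mul_right (by linarith) hfx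
  · refine Or.inl fun x hx => le_antisymm ?_ (hf.nonneg hx)
    by_contra hc
    exact h ⟨x, hx, not_le.1 hc⟩

theorem growthExponent_nonneg {p : ℝ} (hp : IsGrowthExponent f p) : 0 ≤ p :=
  hp.1 ⟨0, le_rfl, by simp⟩

/-- The derivative of `r ^ (-p) * f (r • x)` is nonpositive, by the definition of the growth
exponent. -/
theorem map_smul_le (hf : IsCoveringObjective f) {p : ℝ} (hp : IsGrowthExponent f p)
    {x : Fin n → ℝ} (hx : 0 ≤ x) {s : ℝ} (hs : 1 ≤ s) : f (s • x) ≤ s ^ p * f x := by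
  have hpos : ∀ r ∈ Ioi (0 : ℝ), 0 ≤ r • x := fun r hr => smul_nonneg (le_of_lt hr) hx
  have hd : ∀ r ∈ Ioi (0 : ℝ), HasDerivAt (fun r : ℝ => r ^ (-p) * f (r • x))
      (-p * r ^ (-p - 1) * f (r • x) + r ^ (-p) * (x ⬝ᵥ orthantGrad f (r • x))) r := by
    intro r hr
    have h1 : HasDerivWithinAt (fun r : ℝ => f (r • x)) (x ⬝ᵥ orthantGrad f (r • x)) (Ioi 0) r := by
      refine hf.hasDerivWithinAt_comp (fun i => ?_) hpos hr
      have : HasDerivAt (fun r : ℝ => r * x i) (1 * x i) r := (hasDerivAt_id _).mul_const _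
      simpa using this.hasDerivWithinAt
    have h2 := h1.hasDerivAt (Ioi_mem_nhds hr)
    exact (Real.hasDerivAt_rpow_const (Or.inl (ne_of_gt hr))).mul h2
  have ha : AntitoneOn (fun r : ℝ => r ^ (-p) * f (r • x)) (Ioi 0) := by
    refine antitoneOn_of_deriv_nonpos (convex_Ioi 0)
      (fun r hr => (hd r hr).continuousAt.continuousWithinAt)
      (fun r hr => (hd r (interior_subset hr)).differentiableAt.differentiableWithinAt)
      fun r hr => ?_
    have hr' : 0 < r := interior_subset hr
    rw [(hd r hr').deriv]
    have h3 := hf.dotProduct_grad_le hp (hpos r hr')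
    rw [smul_dotProduct, smul_eq_mul] at h3
    have h4 : r ^ (-p) = r ^ (-p - 1) * r := by
      rw [← Real.rpow_add_one hr'.ne']; ring_nf
    rw [h4]
    have h5 : 0 ≤ r ^ (-p - 1) := Real.rpow_nonneg hr'.le _
    nlinarith
  have := ha (mem_Ioi.2 one_pos) (mem_Ioi.2 (one_pos.trans_le hs)) hs
  simp only [Real.one_rpow, one_smul, one_mul] at this
  have hs0 : 0 < s := one_pos.trans_le hs
  rw [Real.rpow_neg hs0.le, inv_mul_le_iff₀ (Real.rpow_pos_of_pos hs0 p)] at this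
  exact this

/-- Gradient monotonicity moves the zero down to the axis point `x_j e_j`, where then `f` itself
vanishes; the growth bound extends `f = 0` along the ray `M e_j`. A positive `∇_j f(y)` would make
the tangent plane at `y` positive at `M e_j` for large `M`. Hence the growth rate of a non-free
variable is finite as soon as the variable is positive. -/
theorem isFree_of_grad_eq_zero (hf : IsCoveringObjective f) {p : ℝ} (hp : IsGrowthExponent f p)
    {x : Fin n → ℝ} (hx : 0 ≤ x) {j : Fin n} (hxj : 0 < x j) (h0 : orthantGrad f x j = 0) :
    IsFree f j := by
  set e : Fin n → ℝ := Pi.single j (1 : ℝ) with he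
  have he0 : 0 ≤ e := Pi.single_nonneg.2 zero_le_one
  have hz : 0 ≤ x j • e := smul_nonneg hxj.le he0
  have hzx : x j • e ≤ x := by
    intro i
    by_cases hij : i = j
    · subst hij; simp [he]
    · simpa [he, hij] using hx i
  have hgz : orthantGrad f (x j • e) j = 0 :=
    le_antisymm (h0 ▸ hf.grad_mono hz hx hzx j) (hf.grad_nonneg hz j)
  have hfz : f (x j • e) = 0 := by
    refine le_antisymm ((hf.le_dotProduct_grad hz).trans_eq ?_) (hf.nonneg hz)
    rw [smul_dotProduct, he, single_dotProduct, ← he, hgz]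
    simp
  have hray : ∀ M : ℝ, x j ≤ M → f (M • e) = 0 := by
    intro M hM
    refine le_antisymm ?_ (hf.nonneg (smul_nonneg (hxj.le.trans hM) he0))
    have := hf.map_smul_le hp hz ((one_le_div hxj).2 hM)
    rwa [hfz, mul_zero, smul_smul, div_mul_cancel₀ _ hxj.ne'] at this
  intro y hy
  refine le_antisymm ?_ (hf.grad_nonneg hy j)
  by_contra hc
  push Not at hc
  set G := orthantGrad f y j
  set B := y ⬝ᵥ orthantGrad f y
  have hB : 0 ≤ B := (hf.nonneg hy).trans (hf.le_dotProduct_grad hy)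
  set M := x j + (B + 1) / G with hM
  have hMx : x j ≤ M := by
    have : 0 ≤ (B + 1) / G := by positivity
    linarith
  have h1 := hf.add_grad_le hy (smul_nonneg (hxj.le.trans hMx) he0 : 0 ≤ M • e)
  rw [hray M hMx, sub_dotProduct, smul_dotProduct, he, single_dotProduct, one_mul, smul_eq_mul] at h1
  have h2 := hf.nonneg hy
  have h3 : M * G = x j * G + (B + 1) := by rw [hM]; field_simp
  have h4 : 0 ≤ x j * G := by positivity
  change f y + (M * G - B) ≤ 0 at h1
  linarith

theorem grad_pos (hf : IsCoveringObjective f) {p : ℝ} (hp : IsGrowthExponent f p)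
    {x : Fin n → ℝ} (hx : 0 ≤ x) {j : Fin n} (hxj : 0 < x j) (hj : ¬ IsFree f j) :
    0 < orthantGrad f x j :=
  (hf.grad_nonneg hx j).lt_of_ne fun h => hj (hf.isFree_of_grad_eq_zero hp hx hxj h.symm)

/-- The tangent inequality at `z`, evaluated at `(Q p) • w`, reads `f z + Q p ⟨w, ∇f z⟩ - ⟨z, ∇f z⟩
≤ f (Q p w)`. The subtracted term is at most `p f z`, which the hypothesis bounds by the second
term. -/
theorem le_rpow_mul_of_le_dotProduct_grad (hf : IsCoveringObjective f) {p : ℝ}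
    (hp : IsGrowthExponent f p) (hp1 : 1 ≤ p) {z w : Fin n → ℝ} (hz : 0 ≤ z) (hw : 0 ≤ w) {Q : ℝ}
    (hQ : 1 ≤ Q * p) (h : f z ≤ Q * (w ⬝ᵥ orthantGrad f z)) : f z ≤ (Q * p) ^ p * f w := by
  have h1 := hf.add_grad_le hz (smul_nonneg (zero_le_one.trans hQ) hw : 0 ≤ (Q * p) • w)
  rw [sub_dotProduct, smul_dotProduct, smul_eq_mul] at h1
  have h2 := hf.dotProduct_grad_le hp hz
  have h3 : p * f z ≤ p * (Q * (w ⬝ᵥ orthantGrad f z)) :=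
    mul_le_mul_of_nonneg_left h (by linarith)
  have h4 := hf.map_smul_le hp hw hQ
  linarith

/-- For fixed `r` the difference quotient of `f` in direction `e_j` is continuous in the base point;
by convexity, negative `r` bounds the partial derivative from below and positive `r` from above.
Letting `r → 0` at `z` squeezes it. Backward steps need `z j > 0`. -/
theorem continuousWithinAt_grad (hf : IsCoveringObjective f) {z : Fin n → ℝ} (hz : 0 ≤ z)
    {j : Fin n} (hzj : 0 < z j) :
    ContinuousWithinAt (fun x => orthantGrad f x j) (Ici 0) z := by
  set e : Fin n → ℝ := Pi.single j (1 : ℝ) with he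
  set G := orthantGrad f z j with hG
  have hline : HasDerivAt (fun r : ℝ => f (z + r • e)) G 0 := by
    have hs : ∀ r ∈ Ioi (-z j), 0 ≤ z + r • e := by
      intro r hr i
      by_cases hij : i = j
      · subst hij; simp [he]; linarith [mem_Ioi.1 hr]
      · simpa [he, hij] using hz i
    have h0 : (0 : ℝ) ∈ Ioi (-z j) := by simpa using hzj
    have : HasDerivWithinAt (fun r : ℝ => f (z + r • e)) (e ⬝ᵥ orthantGrad f (z + (0 : ℝ) • e))
        (Ioi (-z j)) 0 := by
      refine hf.hasDerivWithinAt_comp (fun i => ?_) hs h0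
      have : HasDerivAt (fun r : ℝ => z i + r * e i) (1 * e i) 0 :=
        ((hasDerivAt_id _).mul_const _).const_add _
      simpa using this.hasDerivWithinAt
    simpa [he, hG] using this.hasDerivAt (Ioi_mem_nhds h0)
  have hquot : ∀ r : ℝ, -z j < r → ContinuousWithinAt (fun x => (f (x + r • e) - f x) / r)
      (Ici 0) z := by
    intro r hr
    have hzr : 0 ≤ z + r • e := by
      intro i
      by_cases hij : i = j
      · subst hij; simp [he]; linarith
      · simpa [he, hij] using hz i
    have h1 : ContinuousWithinAt f (Ici 0) (z + r • e) := (hf.diff _ hzr).continuousWithinAt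
    have hmem : ∀ᶠ x in 𝓝[Ici 0] z, x + r • e ∈ Ici (0 : Fin n → ℝ) := by
      have hj : ∀ᶠ x in 𝓝[Ici 0] z, -r < x j :=
        ((continuous_apply j).continuousAt.eventually (lt_mem_nhds (by linarith))).filter_mono
          nhdsWithin_le_nhds
      filter_upwards [hj, self_mem_nhdsWithin] with x hx hx0 i
      by_cases hij : i = j
      · subst hij; simp [he]; linarith
      · simpa [he, hij] using hx0 i
    have h2 : Tendsto (fun x : Fin n → ℝ => x + r • e) (𝓝[Ici 0] z) (𝓝[Ici 0] (z + r • e)) :=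
      tendsto_nhdsWithin_iff.2
        ⟨((continuous_id.add continuous_const).tendsto z).mono_left nhdsWithin_le_nhds, hmem⟩
    exact ((h1.tendsto.comp h2).sub (hf.diff _ hz).continuousWithinAt).div_const r
  have hslope := hasDerivAt_iff_tendsto_slope.1 hline
  have hsl : ∀ r : ℝ, slope (fun r : ℝ => f (z + r • e)) 0 r = (f (z + r • e) - f z) / r := by
    intro r; simp [slope_def_field]
  simp only [funext hsl] at hslope
  refine tendsto_order.2 ⟨fun b hb => ?_, fun b hb => ?_⟩
  · have hev : ∀ᶠ r : ℝ in 𝓝[<] 0, b < (f (z + r • e) - f z) / r :=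
      (hslope.eventually (lt_mem_nhds hb)).filter_mono
        (nhdsWithin_mono _ fun r hr => ne_of_lt hr)
    have hlt : ∀ᶠ r : ℝ in 𝓝[<] 0, -z j < r :=
      (lt_mem_nhds (by linarith)).filter_mono nhdsWithin_le_nhds
    obtain ⟨r, ⟨hr1, hr2⟩, hr3⟩ := ((hev.and hlt).and self_mem_nhdsWithin).exists
    have hr3' : r < 0 := hr3
    have hj : ∀ᶠ x in 𝓝[Ici 0] z, -r < x j :=
      ((continuous_apply j).continuousAt.eventually (lt_mem_nhds (by linarith))).filter_mono
        nhdsWithin_le_nhds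
    filter_upwards [(hquot r hr2).eventually (lt_mem_nhds hr1), self_mem_nhdsWithin, hj]
      with x hx hx0 hxj
    refine hx.trans_le ?_
    have hxr : 0 ≤ x + r • e := by
      intro i
      by_cases hij : i = j
      · subst hij; simp [he]; linarith
      · simpa [he, hij] using hx0 i
    have := hf.mul_grad_le hx0 j hxr
    rw [div_le_iff_of_neg hr3']
    linarith
  · have hev : ∀ᶠ r : ℝ in 𝓝[>] 0, (f (z + r • e) - f z) / r < b :=
      (hslope.eventually (gt_mem_nhds hb)).filter_mono
        (nhdsWithin_mono _ fun r hr => ne_of_gt hr)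
    obtain ⟨r, hr1, hr3⟩ := (hev.and self_mem_nhdsWithin).exists
    have hr3' : 0 < r := hr3
    filter_upwards [(hquot r (by linarith)).eventually (gt_mem_nhds hr1), self_mem_nhdsWithin]
      with x hx hx0
    refine lt_of_le_of_lt ?_ hx
    have := hf.mul_grad_le hx0 j (add_single_nonneg hx0 j hr3'.le)
    rw [le_div_iff₀ hr3']
    linarith

end IsCoveringObjective

/-- Cutting the interval at the exceptional points, one at a time, reduces to the classical case, as
`h` is continuous across them. -/
theorem monotoneOn_Icc_of_hasDerivAt_nonneg_off_finite {h : ℝ → ℝ} {S : Set ℝ} (hS : S.Finite) :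
    ∀ {a b : ℝ}, ContinuousOn h (Icc a b) →
      (∀ τ ∈ Ioo a b, τ ∉ S → ∃ h', HasDerivAt h h' τ ∧ 0 ≤ h') → MonotoneOn h (Icc a b) := by
  induction S, hS using Set.Finite.induction_on with
  | empty =>
    intro a b hc hd
    refine monotoneOn_of_deriv_nonneg (convex_Icc a b) hc ?_ ?_
    · rw [interior_Icc]
      intro τ hτ
      obtain ⟨h', h1, -⟩ := hd τ hτ (notMem_empty τ)
      exact h1.differentiableAt.differentiableWithinAt
    · rw [interior_Icc]
      intro τ hτ
      obtain ⟨h', h1, h2⟩ := hd τ hτ (notMem_empty τ)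
      rwa [h1.deriv]
  | @insert s S _ _ ih =>
    intro a b hc hd
    by_cases hs : s ∈ Ioo a b
    · rw [← Icc_union_Icc_eq_Icc hs.1.le hs.2.le]
      refine MonotoneOn.union_right (c := s) (ih ?_ ?_) (ih ?_ ?_) (isGreatest_Icc hs.1.le)
        (isLeast_Icc hs.2.le)
      · exact hc.mono (Icc_subset_Icc_right hs.2.le)
      · intro τ hτ hτS
        exact hd τ ⟨hτ.1, hτ.2.trans hs.2⟩ (by simp [hτS, hτ.2.ne])
      · exact hc.mono (Icc_subset_Icc_left hs.1.le)
      · intro τ hτ hτS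
        exact hd τ ⟨hs.1.trans hτ.1, hτ.2⟩ (by simp [hτS, hτ.1.ne'])
    · refine ih hc fun τ hτ hτS => hd τ hτ ?_
      rintro (rfl | h)
      exacts [hs hτ, hτS h]

/-! ### Bounds for the additive terms `D_j` -/

section GrowthTerm

variable {n d : ℕ} {lam : ℝ} {x' a x : Fin n → ℝ}

theorem adviceLeft_nonneg (hx' : 0 ≤ x') : 0 ≤ adviceLeft x' x := by
  intro j
  unfold adviceLeft
  split_ifs
  exacts [hx' j, le_rfl]

theorem growthTerm_nonneg (hx' : 0 ≤ x') (h0 : 0 ≤ lam) (h1 : lam ≤ 1) (ha : 0 ≤ a) (j : Fin n) :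
    0 ≤ growthTerm d lam x' a x j := by
  have haj := ha j
  have h2 : 0 ≤ adviceLeft x' x j := adviceLeft_nonneg hx' j
  have h3 : 0 ≤ a ⬝ᵥ adviceLeft x' x := dotProduct_nonneg_of_nonneg ha (adviceLeft_nonneg hx')
  have h4 : 0 ≤ 1 - lam := by linarith
  simp only [Pi.zero_apply] at haj
  unfold growthTerm
  split_ifs <;> positivity

/-- The uniform share contributes at most `λ` and the advice share `1 - λ`. Equality can fail: the
row may have fewer than `d` entries, or `a ⬝ᵥ adviceLeft x' x` may be `0`, and then the advice share
is `0/0 = 0`. -/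
theorem sum_mul_growthTerm_le (h0 : 0 ≤ lam) (h1 : lam ≤ 1) (ha : 0 ≤ a)
    (hd : (Finset.univ.filter fun j => 0 < a j).card ≤ d) :
    ∑ j, a j * growthTerm d lam x' a x j ≤ 1 := by
  have key : ∀ μ : ℝ, 0 ≤ μ → ∑ j, a j * (μ / (a j * d)) ≤ μ := by
    intro μ hμ
    have h2 : ∀ j, a j * (μ / (a j * d)) = if 0 < a j then μ / d else 0 := by
      intro j
      split_ifs with h
      · field_simp
      · rw [le_antisymm (not_lt.1 h) (ha j)]; simp
    simp only [h2]
    rw [← Finset.sum_filter, Finset.sum_const, nsmul_eq_mul]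
    have h3 : ((Finset.univ.filter fun j => 0 < a j).card : ℝ) / d ≤ 1 :=
      div_le_one_of_le₀ (by exact_mod_cast hd) (by positivity)
    calc _ = ((Finset.univ.filter fun j => 0 < a j).card : ℝ) / d * μ := by ring
      _ ≤ 1 * μ := by gcongr
      _ = μ := one_mul μ
  by_cases h : 1 ≤ a ⬝ᵥ x'
  · simp only [growthTerm, h, if_true, mul_add, Finset.sum_add_distrib]
    have h2 : ∑ j, a j * ((1 - lam) * adviceLeft x' x j / (a ⬝ᵥ adviceLeft x' x)) =
        (1 - lam) * ((a ⬝ᵥ adviceLeft x' x) / (a ⬝ᵥ adviceLeft x' x)) := by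
      nth_rewrite 2 [dotProduct]
      rw [Finset.sum_div, Finset.mul_sum]
      exact Finset.sum_congr rfl fun j _ => by ring
    rw [h2]
    have h3 := mul_le_mul_of_nonneg_left (div_self_le_one (a ⬝ᵥ adviceLeft x' x))
      (by linarith : 0 ≤ 1 - lam)
    linarith [key lam h0]
  · simp only [growthTerm, h, if_false]
    exact key 1 zero_le_one

theorem le_growthTerm (hx' : 0 ≤ x') (h1 : lam ≤ 1) (ha : 0 ≤ a) (j : Fin n) :
    lam / (a j * d) ≤ growthTerm d lam x' a x j := by
  have haj : 0 ≤ a j := ha j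
  have h2 : 0 ≤ adviceLeft x' x j := adviceLeft_nonneg hx' j
  have h3 : 0 ≤ a ⬝ᵥ adviceLeft x' x := dotProduct_nonneg_of_nonneg ha (adviceLeft_nonneg hx')
  have h4 : 0 ≤ 1 - lam := by linarith
  unfold growthTerm
  split_ifs
  · have : 0 ≤ (1 - lam) * adviceLeft x' x j / (a ⬝ᵥ adviceLeft x' x) := by positivity
    linarith
  · gcongr

theorem le_growthTerm_of_advice (h0 : 0 ≤ lam) (ha : 0 ≤ a) (h : 1 ≤ a ⬝ᵥ x') {j : Fin n}
    (hj : x j < x' j) :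
    (1 - lam) * x' j / (a ⬝ᵥ adviceLeft x' x) ≤ growthTerm d lam x' a x j := by
  have haj : 0 ≤ a j := ha j
  have : 0 ≤ lam / (a j * d) := by positivity
  simp only [growthTerm, h, if_true]
  simp only [adviceLeft, hj, if_true] at this ⊢
  linarith

end GrowthTerm

/-- The potential which measures the progress of `x` towards `w`, with weights `g`. -/
noncomputable def coveringPotential {n : ℕ} (g w : Fin n → ℝ) (δ N : ℝ) (x : Fin n → ℝ) : ℝ :=
  ∑ j, g j * (w j * (Real.log (x j + δ * w j) - Real.log (x j + N * w j)))

/-- A lower bound for the speed at which `coveringPotential` grows. -/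
noncomputable def potentialRate {n : ℕ} (d : ℕ) (lam : ℝ) (x' a w : Fin n → ℝ) (δ N : ℝ)
    (x : Fin n → ℝ) : ℝ :=
  ∑ j, a j * w j * ((x j + growthTerm d lam x' a x j) / (x j + δ * w j)) *
    ((N - δ) * w j / (x j + N * w j))

/-! ### The logarithmic potential and its rate of growth -/

section Potential

variable {n d : ℕ} {lam : ℝ} {x' a x w g : Fin n → ℝ} {δ N : ℝ}

theorem potentialRate_term_nonneg (hx' : 0 ≤ x') (h0 : 0 ≤ lam) (h1 : lam ≤ 1) (ha : 0 ≤ a)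
    (hx : 0 ≤ x) (hw : 0 ≤ w) (hδ : 0 < δ) (hN : δ ≤ N) (j : Fin n) :
    0 ≤ a j * w j * ((x j + growthTerm d lam x' a x j) / (x j + δ * w j)) *
      ((N - δ) * w j / (x j + N * w j)) := by
  have haj : 0 ≤ a j := ha j
  have hwj : 0 ≤ w j := hw j
  have hxj : 0 ≤ x j := hx j
  have hD : 0 ≤ growthTerm d lam x' a x j := growthTerm_nonneg hx' h0 h1 ha j
  have hNδ : 0 ≤ N - δ := by linarith
  have hN0 : 0 ≤ N := by linarith
  positivity

theorem potentialRate_nonneg (hx' : 0 ≤ x') (h0 : 0 ≤ lam) (h1 : lam ≤ 1) (ha : 0 ≤ a)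
    (hx : 0 ≤ x) (hw : 0 ≤ w) (hδ : 0 < δ) (hN : δ ≤ N) :
    0 ≤ potentialRate d lam x' a w δ N x :=
  Finset.sum_nonneg fun j _ => potentialRate_term_nonneg hx' h0 h1 ha hx hw hδ hN j

theorem coveringPotential_mono (hg : 0 ≤ g) (hw : 0 ≤ w) (hδ : 0 < δ) (hN : δ ≤ N)
    {u v : Fin n → ℝ} (hu : 0 ≤ u) (huv : u ≤ v) :
    coveringPotential g w δ N u ≤ coveringPotential g w δ N v := by
  refine Finset.sum_le_sum fun j _ => mul_le_mul_of_nonneg_left ?_ (hg j)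
  rcases (hw j).eq_or_lt with h | h
  · simp only [Pi.zero_apply] at h
    simp [← h]
  · refine mul_le_mul_of_nonneg_left ?_ (hw j)
    simp only [Pi.zero_apply] at h
    have hu1 : 0 ≤ u j := hu j
    have huv1 : u j ≤ v j := huv j
    have hv1 : 0 ≤ v j := hu1.trans huv1
    have hN0 : 0 < N := hδ.trans_le hN
    have e : Real.log ((u j + δ * w j) * (v j + N * w j)) ≤
        Real.log ((v j + δ * w j) * (u j + N * w j)) := by
      refine Real.log_le_log (by positivity) ?_
      nlinarith [mul_nonneg (sub_nonneg.2 huv1) (mul_nonneg (sub_nonneg.2 hN) h.le)]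
    rw [Real.log_mul (by positivity) (by positivity), Real.log_mul (by positivity) (by positivity)]
      at e
    linarith

/-- Each difference of logarithms is `-log(N/δ)` at `0` and stays nonpositive because `δ ≤ N`. -/
theorem coveringPotential_sub_le (hg : 0 ≤ g) (hw : 0 ≤ w) (hδ : 0 < δ) (hN : δ ≤ N) (hx : 0 ≤ x) :
    coveringPotential g w δ N x - coveringPotential g w δ N 0 ≤
      Real.log (N / δ) * (w ⬝ᵥ g) := by
  unfold coveringPotential
  rw [← Finset.sum_sub_distrib, dotProduct, Finset.mul_sum]
  refine Finset.sum_le_sum fun j _ => ?_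
  rcases (hw j).eq_or_lt with h | h
  · simp only [Pi.zero_apply] at h
    simp [← h]
  · simp only [Pi.zero_apply] at h
    have hN0 : 0 < N := hδ.trans_le hN
    have hxj : 0 ≤ x j := hx j
    have h1 : Real.log (x j + δ * w j) ≤ Real.log (x j + N * w j) :=
      Real.log_le_log (by positivity) (by gcongr)
    have h2 : Real.log (N / δ) = Real.log (N * w j) - Real.log (δ * w j) := by
      rw [Real.log_div hN0.ne' hδ.ne', Real.log_mul hN0.ne' h.ne', Real.log_mul hδ.ne' h.ne']
      ring
    rw [h2]
    simp only [Pi.zero_apply, zero_add]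
    have h3 : 0 ≤ g j * w j := mul_nonneg (hg j) h.le
    nlinarith [mul_nonneg h3 (sub_nonneg.2 h1)]

theorem hasDerivAt_coveringPotential (hw : 0 ≤ w) (hδ : 0 < δ) (hN : δ ≤ N) {X : ℝ → Fin n → ℝ}
    {v : Fin n → ℝ} {τ : ℝ} (hX : 0 ≤ X τ) (hv : ∀ j, HasDerivAt (fun s => X s j) (v j) τ) :
    HasDerivAt (fun s => coveringPotential g w δ N (X s))
      (∑ j, g j * v j * (w j / (X τ j + δ * w j)) * ((N - δ) * w j / (X τ j + N * w j))) τ := by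
  refine HasDerivAt.fun_sum fun j _ => ?_
  rcases (hw j).eq_or_lt with h | h
  · simp only [Pi.zero_apply] at h
    simpa [← h] using hasDerivAt_const τ (0 : ℝ)
  · simp only [Pi.zero_apply] at h
    have hN0 : 0 < N := hδ.trans_le hN
    have hXj : 0 ≤ X τ j := hX j
    have h1 : X τ j + δ * w j ≠ 0 := by positivity
    have h2 : X τ j + N * w j ≠ 0 := by positivity
    refine ((((((hv j).add_const (δ * w j)).log h1).sub
      (((hv j).add_const (N * w j)).log h2)).const_mul (w j)).const_mul (g j)).congr_deriv ?_
    field_simp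
    ring

theorem continuousOn_coveringPotential (hw : 0 ≤ w) (hδ : 0 < δ) (hN : δ ≤ N) :
    ContinuousOn (coveringPotential g w δ N) (Ici 0) := by
  refine continuousOn_finsetSum _ fun j _ => continuousOn_const.mul ?_
  rcases (hw j).eq_or_lt with h | h
  · simp only [Pi.zero_apply] at h
    simpa [← h] using continuousOn_const
  · simp only [Pi.zero_apply] at h
    have hN0 : 0 < N := hδ.trans_le hN
    refine continuousOn_const.mul (ContinuousOn.sub ?_ ?_)
    all_goals
      refine ContinuousOn.log (by fun_prop) fun x hx => ?_
      have hxj : 0 ≤ x j := hx j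
      positivity

theorem min_one_sum_le {b : Fin n → ℝ} (hb : 0 ≤ b) (h : 1 ≤ ∑ j, b j) :
    1 ≤ ∑ j, min 1 (b j) := by
  by_cases hj : ∃ j, 1 ≤ b j
  · obtain ⟨j, hj⟩ := hj
    calc (1 : ℝ) = min 1 (b j) := (min_eq_left hj).symm
      _ ≤ _ := Finset.single_le_sum (f := fun j => min 1 (b j))
        (fun i _ => le_min zero_le_one (hb i)) (Finset.mem_univ j)
  · push Not at hj
    refine h.trans (Finset.sum_le_sum fun j _ => ?_)
    rw [min_eq_right (hj j).le]

/-- Coordinates with `x_j ≤ 2 d z_j` contribute at least `min(1, a_j z_j)/2`: there the saturation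
factor is at least `1/2`, and `z(ax + δ)/(x + δz)` lies between `1` and `az`. For the other
coordinates `a_j z_j ≤ a_j x_j/(2d)`, and these losses sum to at most `1/2` as `a·x ≤ 1`. The
truncated sum is still at least `1`, which leaves `(1 - 1/2)/2`. -/
theorem le_potentialRate_of_cover {z : Fin n → ℝ} {μ : ℝ} (hx' : 0 ≤ x') (h0 : 0 ≤ lam)
    (h1 : lam ≤ 1) (ha : 0 ≤ a) (hx : 0 ≤ x) (hz : 0 ≤ z) (haz : 1 ≤ a ⬝ᵥ z) (hax : a ⬝ᵥ x ≤ 1)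
    (hd : 1 ≤ d) (hμ : 0 < μ) (hμ1 : μ ≤ 1)
    (hD : ∀ j, 0 < a j → μ / (a j * d) ≤ growthTerm d lam x' a x j) :
    1 / 4 ≤ potentialRate d lam x' a z (μ / d) (4 * d) x := by
  have hd1 : (1 : ℝ) ≤ d := by exact_mod_cast hd
  have hd0 : (0 : ℝ) < d := by linarith
  set δ : ℝ := μ / d with hδ
  have hδ0 : 0 < δ := by positivity
  have hδ1 : δ ≤ 1 := div_le_one_of_le₀ (by linarith) hd0.le
  have key : ∀ j, (min 1 (a j * z j) - a j * x j / (2 * d)) / 2 ≤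
      a j * z j * ((x j + growthTerm d lam x' a x j) / (x j + δ * z j)) *
        ((4 * d - δ) * z j / (x j + 4 * d * z j)) := by
    intro j
    have hT := potentialRate_term_nonneg (d := d) hx' h0 h1 ha hx hz hδ0
      (by linarith : δ ≤ 4 * d) j
    have haj : 0 ≤ a j := ha j
    have hzj : 0 ≤ z j := hz j
    have hxj : 0 ≤ x j := hx j
    have hax0 : 0 ≤ a j * x j / (2 * d) := by positivity
    rcases haj.eq_or_lt with h | haj'
    · refine le_trans ?_ hT
      simp [← h]
    rcases hzj.eq_or_lt with h | hzj'
    · refine le_trans ?_ hT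
      rw [← h]
      simp only [mul_zero]
      rw [min_eq_right zero_le_one]
      linarith
    by_cases hJ : x j ≤ 2 * d * z j
    · have e1 : min 1 (a j * z j) ≤
          a j * z j * ((x j + growthTerm d lam x' a x j) / (x j + δ * z j)) := by
        have hpos : 0 < x j + δ * z j := by positivity
        have e3 : a j * x j + δ ≤ a j * (x j + growthTerm d lam x' a x j) := by
          have : a j * (μ / (a j * d)) = δ := by rw [hδ]; field_simp
          nlinarith [mul_le_mul_of_nonneg_left (hD j haj') haj]
        have e4 : z j * (a j * x j + δ) ≤ a j * z j * (x j + growthTerm d lam x' a x j) := by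
          nlinarith [mul_le_mul_of_nonneg_left e3 hzj]
        rw [mul_div_assoc', le_div_iff₀ hpos]
        refine le_trans ?_ e4
        rcases le_total (a j * z j) 1 with h | h
        · rw [min_eq_right h]
          nlinarith [mul_nonneg (mul_nonneg hδ0.le hzj) (sub_nonneg.2 h)]
        · rw [min_eq_left h]
          nlinarith [mul_nonneg hxj (sub_nonneg.2 h)]
      have e2 : 1 / 2 ≤ (4 * d - δ) * z j / (x j + 4 * d * z j) := by
        rw [le_div_iff₀ (by positivity)]
        nlinarith [mul_nonneg (by linarith : 0 ≤ (d : ℝ) - δ) hzj]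
      have e5 : 0 ≤ min 1 (a j * z j) := le_min zero_le_one (by positivity)
      have := mul_le_mul e1 e2 (by norm_num) (e5.trans e1)
      linarith
    · refine le_trans ?_ hT
      push Not at hJ
      have : a j * z j ≤ a j * x j / (2 * d) := by
        rw [le_div_iff₀ (by positivity)]
        nlinarith [mul_le_mul_of_nonneg_left hJ.le haj]
      linarith [min_le_right 1 (a j * z j)]
  refine le_trans ?_ (Finset.sum_le_sum fun j _ => key j)
  rw [← Finset.sum_div, Finset.sum_sub_distrib, ← Finset.sum_div]
  have s1 := min_one_sum_le (b := fun j => a j * z j) (fun j => mul_nonneg (ha j) (hz j)) haz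
  have s2 : (∑ j, a j * x j) / (2 * d) ≤ 1 / 2 := by
    rw [div_le_div_iff₀ (by positivity) (by norm_num)]
    have : ∑ j, a j * x j ≤ 1 := hax
    linarith
  linarith

/-- Let `σ` be the part of `a·x'` on coordinates that have not reached the advice. If `σ ≤ 1`, an
unreached coordinate has `D_j ≥ κ x'_j`, and a reached one has `x_j ≥ κ x'_j` by itself; both ratios
are at least `1/2`, and coordinates with `x_j > 2 x'_j` lose at most `a·x/2 ≤ 1/2`. If `σ > 1`, the
unreached coordinates suffice: their ratios are at least `1/σ` and their weights `a_j x'_j` sum to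
`σ`. -/
theorem le_potentialRate_of_advice (hx' : 0 ≤ x') (h0 : 0 ≤ lam) (h1 : lam < 1) (ha : 0 ≤ a)
    (hx : 0 ≤ x) (hax' : 1 ≤ a ⬝ᵥ x') (hax : a ⬝ᵥ x ≤ 1) :
    1 / 8 ≤ potentialRate d lam x' a x' (1 - lam) 4 x := by
  set κ := 1 - lam with hκ
  have hκ0 : 0 < κ := by linarith
  have hκ1 : κ ≤ 1 := by linarith
  have hT := potentialRate_term_nonneg (d := d) hx' h0 h1.le ha hx hx' hκ0 (by linarith : κ ≤ 4)
  have hsecond : ∀ j, 0 < x' j → x j ≤ 2 * x' j →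
      1 / 2 ≤ (4 - κ) * x' j / (x j + 4 * x' j) := by
    intro j hj hxj'
    have hxj : 0 ≤ x j := hx j
    rw [le_div_iff₀ (by positivity)]
    nlinarith [mul_nonneg (sub_nonneg.2 hκ1) hj.le]
  set σ := a ⬝ᵥ adviceLeft x' x with hσ
  have hσ0 : 0 ≤ σ := dotProduct_nonneg_of_nonneg ha (adviceLeft_nonneg hx')
  rcases le_or_gt σ 1 with hσ1 | hσ1
  · have key : ∀ j, (a j * x' j - a j * x j / 2) / 4 ≤
        a j * x' j * ((x j + growthTerm d lam x' a x j) / (x j + κ * x' j)) *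
          ((4 - κ) * x' j / (x j + 4 * x' j)) := by
      intro j
      have haj : 0 ≤ a j := ha j
      have hxj' : 0 ≤ x' j := hx' j
      have hxj : 0 ≤ x j := hx j
      have hD := growthTerm_nonneg (d := d) (x := x) hx' h0 h1.le ha j
      have hax0 : 0 ≤ a j * x j / 2 := by positivity
      rcases haj.eq_or_lt with h | haj'
      · refine le_trans ?_ (hT j)
        simp [← h]
      rcases hxj'.eq_or_lt with h | hxj''
      · refine le_trans ?_ (hT j)
        rw [← h]
        linarith
      by_cases hJ : x j ≤ 2 * x' j
      · have e1 : 1 / 2 ≤ (x j + growthTerm d lam x' a x j) / (x j + κ * x' j) := by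
          rw [le_div_iff₀ (by positivity)]
          by_cases hlt : x j < x' j
          · have hσpos : 0 < σ := by
              refine lt_of_lt_of_le (mul_pos haj' hxj'') ?_
              have : a j * x' j = a j * adviceLeft x' x j := by simp [adviceLeft, hlt]
              rw [this]
              exact Finset.single_le_sum (f := fun j => a j * adviceLeft x' x j)
                (fun i _ => mul_nonneg (ha i) (adviceLeft_nonneg hx' i)) (Finset.mem_univ j)
            have e3 := le_growthTerm_of_advice (d := d) h0 ha hax' hlt
            have e4 : κ * x' j ≤ κ * x' j / σ := by
              rw [le_div_iff₀ hσpos]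
              exact mul_le_of_le_one_right (by positivity) hσ1
            have e5 : 0 ≤ κ * x' j := by positivity
            linarith
          · push Not at hlt
            nlinarith [mul_nonneg (sub_nonneg.2 hκ1) hxj']
        have e2 := hsecond j hxj'' hJ
        have e6 : 0 ≤ a j * x' j := by positivity
        have := mul_le_mul (mul_le_mul_of_nonneg_left e1 e6) e2 (by norm_num)
          (mul_nonneg e6 (le_trans (by norm_num) e1))
        linarith
      · refine le_trans ?_ (hT j)
        push Not at hJ
        nlinarith [mul_le_mul_of_nonneg_left hJ.le haj]
    refine le_trans ?_ (Finset.sum_le_sum fun j _ => key j)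
    rw [← Finset.sum_div, Finset.sum_sub_distrib, ← Finset.sum_div]
    have s1 : 1 ≤ ∑ j, a j * x' j := hax'
    have s2 : ∑ j, a j * x j ≤ 1 := hax
    linarith
  · have key : ∀ j, a j * adviceLeft x' x j / σ / 2 ≤
        a j * x' j * ((x j + growthTerm d lam x' a x j) / (x j + κ * x' j)) *
          ((4 - κ) * x' j / (x j + 4 * x' j)) := by
      intro j
      have haj : 0 ≤ a j := ha j
      have hxj : 0 ≤ x j := hx j
      by_cases hlt : x j < x' j
      · have hxj' : 0 < x' j := hxj.trans_lt hlt
        have e3 := le_growthTerm_of_advice (d := d) h0 ha hax' hlt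
        have e1 : 1 / σ ≤ (x j + growthTerm d lam x' a x j) / (x j + κ * x' j) := by
          rw [le_div_iff₀ (by positivity)]
          have : x j / σ ≤ x j := div_le_self hxj hσ1.le
          calc 1 / σ * (x j + κ * x' j) = x j / σ + κ * x' j / σ := by ring
            _ ≤ _ := add_le_add this e3
        have e2 := hsecond j hxj' (by linarith)
        have e6 : 0 ≤ a j * x' j := by positivity
        have e7 : 0 ≤ 1 / σ := by positivity
        have := mul_le_mul (mul_le_mul_of_nonneg_left e1 e6) e2 (by norm_num)
          (mul_nonneg e6 (e7.trans e1))
        simp only [adviceLeft, hlt, if_true]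
        calc _ = a j * x' j * (1 / σ) * (1 / 2) := by ring
          _ ≤ _ := this
      · refine le_trans ?_ (hT j)
        simp [adviceLeft, hlt]
    refine le_trans ?_ (Finset.sum_le_sum fun j _ => key j)
    rw [← Finset.sum_div, ← Finset.sum_div]
    have : (∑ j, a j * adviceLeft x' x j) / σ = 1 :=
      div_self (zero_lt_one.trans hσ1).ne'
    rw [this]
    norm_num

end Potential

/-! ### A single round: monotonicity, feasibility, payment by time -/

section Round

variable {n d : ℕ} {f : (Fin n → ℝ) → ℝ} {p lam T : ℝ} {x' a u v : Fin n → ℝ} {X : ℝ → Fin n → ℝ}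

theorem IsGrowthPath.exists_hasDerivAt (hX : IsGrowthPath f d lam x' a u T X)
    (hf : IsCoveringObjective f) (hp : IsGrowthExponent f p)
    (hx' : 0 ≤ x') (h0 : 0 ≤ lam) (h1 : lam ≤ 1) (ha : 0 ≤ a)
    (hfree : ∀ j, 0 < a j → ¬ IsFree f j) :
    ∃ S : Set ℝ, S.Finite ∧ ∀ τ ∈ Ioo 0 T, τ ∉ S → ∃ v : Fin n → ℝ, 0 ≤ v ∧
      (∀ j, HasDerivAt (fun s => X s j) (v j) τ) ∧
      ∀ j, orthantGrad f (X τ) j * v j = a j * (X τ j + growthTerm d lam x' a (X τ) j) := by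
  obtain ⟨S, hS, hrate⟩ := hX.rate
  refine ⟨S, hS, fun τ hτ hτS => ?_⟩
  have hnn := hX.nonneg τ (Ioo_subset_Icc_self hτ)
  have key : ∀ j, ∃ v : ℝ, 0 ≤ v ∧ HasDerivAt (fun s => X s j) v τ ∧
      orthantGrad f (X τ) j * v = a j * (X τ j + growthTerm d lam x' a (X τ) j) := by
    intro j
    rcases (ha j).eq_or_lt with h | h
    · simp only [Pi.zero_apply] at h
      refine ⟨0, le_rfl, ?_, by simp [← h]⟩
      refine (hasDerivAt_const τ (u j)).congr_of_eventuallyEq ?_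
      filter_upwards [Ioo_mem_nhds hτ.1 hτ.2] with s hs
      exact hX.fixed s (Ioo_subset_Icc_self hs) j h.symm
    · obtain ⟨v, hv, hv'⟩ := hrate τ hτ hτS j h
      refine ⟨v, ?_, hv, hv'⟩
      have hXj : 0 ≤ X τ j := hnn j
      rcases hXj.eq_or_lt with h2 | h2
      -- At a zero of `X_j` the gradient may vanish, and the multiplied equation need not determine
      -- `v`; nonnegativity of the path makes `τ` a local minimum instead, so `v = 0`.
      · have hmin : IsLocalMin (fun s => X s j) τ := by
          filter_upwards [Ioo_mem_nhds hτ.1 hτ.2] with s hs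
          rw [← h2]
          exact hX.nonneg s (Ioo_subset_Icc_self hs) j
        exact (hmin.hasDerivAt_eq_zero hv).ge
      · have hpos := hf.grad_pos hp hnn h2 (hfree j h)
        have hD := growthTerm_nonneg (d := d) (x := X τ) hx' h0 h1 ha j
        have : 0 ≤ orthantGrad f (X τ) j * v := by
          rw [hv']
          exact mul_nonneg h.le (add_nonneg hXj hD)
        exact nonneg_of_mul_nonneg_right this hpos
  choose v hv1 hv2 hv3 using key
  exact ⟨v, hv1, hv2, hv3⟩

theorem IsGrowthPath.monotoneOn (hX : IsGrowthPath f d lam x' a u T X)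
    (hf : IsCoveringObjective f) (hp : IsGrowthExponent f p)
    (hx' : 0 ≤ x') (h0 : 0 ≤ lam) (h1 : lam ≤ 1) (ha : 0 ≤ a)
    (hfree : ∀ j, 0 < a j → ¬ IsFree f j) : MonotoneOn X (Icc 0 T) := by
  obtain ⟨S, hS, hd⟩ := hX.exists_hasDerivAt hf hp hx' h0 h1 ha hfree
  intro s hs t ht hst j
  refine monotoneOn_Icc_of_hasDerivAt_nonneg_off_finite (h := fun r => X r j) hS
    ((continuous_apply j).comp_continuousOn hX.cont) (fun τ hτ hτS => ?_) hs ht hst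
  obtain ⟨v, hv1, hv2, -⟩ := hd τ hτ hτS
  exact ⟨v j, hv2 j, hv1 j⟩

theorem PDLARound.le_and_cover (hr : PDLARound f d lam x' a u v)
    (hf : IsCoveringObjective f) (hp : IsGrowthExponent f p)
    (hx' : 0 ≤ x') (h0 : 0 ≤ lam) (h1 : lam ≤ 1) (ha : 0 ≤ a) : u ≤ v ∧ 1 ≤ a ⬝ᵥ v := by
  cases hr with
  | satisfied h => exact ⟨le_rfl, h⟩
  | grow h hfree T X hX =>
    refine ⟨?_, hX.final⟩
    have := hX.monotoneOn hf hp hx' h0 h1 ha hfree (left_mem_Icc.2 hX.pos.le)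
      (right_mem_Icc.2 hX.pos.le) hX.pos.le
    rwa [hX.start] at this
  | jump h hfree _ hle hfix hav => exact ⟨hle, hav.ge⟩

/-- The time `y` of a round pays for the increase of the objective, and it is paid for by the
increase of the potentials. -/
theorem PDLARound.exists_time (hr : PDLARound f d lam x' a u v)
    (hf : IsCoveringObjective f) (hp : IsGrowthExponent f p)
    (hx' : 0 ≤ x') (h0 : 0 ≤ lam) (h1 : lam ≤ 1) (ha : 0 ≤ a)
    (hd : (Finset.univ.filter fun j => 0 < a j).card ≤ d) (hu : 0 ≤ u) :
    ∃ y : ℝ, 0 ≤ y ∧ f v - f u ≤ 2 * y ∧ ∀ z w : Fin n → ℝ, v ≤ z → 0 ≤ w → ∀ δ N c : ℝ,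
      0 < δ → δ ≤ N → (∀ x, 0 ≤ x → a ⬝ᵥ x < 1 → c ≤ potentialRate d lam x' a w δ N x) →
      c * y ≤ coveringPotential (orthantGrad f z) w δ N v -
        coveringPotential (orthantGrad f z) w δ N u := by
  have huv := (hr.le_and_cover hf hp hx' h0 h1 ha).1
  cases hr with
  | satisfied h => exact ⟨0, le_rfl, by simp, by simp⟩
  | grow h hfree T X hX =>
    have hmono := hX.monotoneOn hf hp hx' h0 h1 ha hfree
    obtain ⟨S, hS, hder⟩ := hX.exists_hasDerivAt hf hp hx' h0 h1 ha hfree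
    have hl : (0 : ℝ) ∈ Icc 0 T := left_mem_Icc.2 hX.pos.le
    have hT : T ∈ Icc 0 T := right_mem_Icc.2 hX.pos.le
    have hmaps : MapsTo X (Icc 0 T) (Ici 0) := hX.nonneg
    refine ⟨T, hX.pos.le, ?_, ?_⟩
    · have hm : MonotoneOn (fun τ => 2 * τ - f (X τ)) (Icc 0 T) := by
        refine monotoneOn_Icc_of_hasDerivAt_nonneg_off_finite hS ?_ fun τ hτ hτS => ?_
        · exact (continuousOn_const.mul continuousOn_id).sub
            (hf.diff.continuousOn.comp hX.cont hmaps)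
        · obtain ⟨v, -, hv2, hv3⟩ := hder τ hτ hτS
          have hfd : HasDerivAt (fun r => f (X r)) (v ⬝ᵥ orthantGrad f (X τ)) τ :=
            (hf.hasDerivWithinAt_comp (fun j => (hv2 j).hasDerivWithinAt) hX.nonneg
              (Ioo_subset_Icc_self hτ)).hasDerivAt (Icc_mem_nhds hτ.1 hτ.2)
          refine ⟨_, ((hasDerivAt_id τ).const_mul 2).sub hfd, ?_⟩
          -- The gradient cancels against the rates: `f` grows at speed `a·x + ∑ a_j D_j`, where
          -- both summands are at most `1`.
          have e1 : v ⬝ᵥ orthantGrad f (X τ) =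
              a ⬝ᵥ X τ + ∑ j, a j * growthTerm d lam x' a (X τ) j := by
            rw [dotProduct, dotProduct, ← Finset.sum_add_distrib]
            refine Finset.sum_congr rfl fun j _ => ?_
            rw [mul_comm, hv3 j, mul_add]
          have e2 := sum_mul_growthTerm_le (x' := x') (x := X τ) h0 h1 ha hd
          have e3 := hX.unsat τ ⟨hτ.1.le, hτ.2⟩
          rw [e1]
          linarith
      have := hm hl hT hX.pos.le
      simp only [hX.start] at this
      linarith
    · intro z w hz hw δ N c hδ hN hc
      set g := orthantGrad f z with hg
      have hu0 : 0 ≤ X T := hX.nonneg T hT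
      have hm : MonotoneOn (fun τ => coveringPotential g w δ N (X τ) - c * τ) (Icc 0 T) := by
        refine monotoneOn_Icc_of_hasDerivAt_nonneg_off_finite hS ?_ fun τ hτ hτS => ?_
        · exact ((continuousOn_coveringPotential hw hδ hN).comp hX.cont hmaps).sub
            (continuousOn_const.mul continuousOn_id)
        · obtain ⟨v, hv1, hv2, hv3⟩ := hder τ hτ hτS
          have hτ' := Ioo_subset_Icc_self hτ
          have hXτ : 0 ≤ X τ := hX.nonneg τ hτ'
          refine ⟨_, (hasDerivAt_coveringPotential hw hδ hN hXτ hv2).sub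
            ((hasDerivAt_id τ).const_mul c), ?_⟩
          rw [mul_one, sub_nonneg]
          refine (hc (X τ) hXτ (hX.unsat τ ⟨hτ.1.le, hτ.2⟩)).trans ?_
          refine Finset.sum_le_sum fun j _ => ?_
          -- Gradient monotonicity enters here: the weight `g_j`, taken at a point above the whole
          -- path, dominates the current partial derivative.
          have e1 : a j * (X τ j + growthTerm d lam x' a (X τ) j) ≤ g j * v j := by
            rw [← hv3 j]
            refine mul_le_mul_of_nonneg_right ?_ (hv1 j)
            exact hf.grad_mono hXτ (hu0.trans hz) ((hmono hτ' hT hτ.2.le).trans hz) j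
          have hwj : 0 ≤ w j := hw j
          have hXj : 0 ≤ X τ j := hXτ j
          have hN0 : 0 ≤ N - δ := by linarith
          have hN1 : 0 < N := by linarith
          calc a j * w j * ((X τ j + growthTerm d lam x' a (X τ) j) / (X τ j + δ * w j)) *
                ((N - δ) * w j / (X τ j + N * w j))
              = a j * (X τ j + growthTerm d lam x' a (X τ) j) * (w j / (X τ j + δ * w j)) *
                ((N - δ) * w j / (X τ j + N * w j)) := by ring
            _ ≤ _ := by gcongr
      have := hm hl hT hX.pos.le
      simp only [hX.start] at this
      linarith
  | jump h hfree _ huv' hfix hav =>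
    refine ⟨0, le_rfl, ?_, ?_⟩
    · have hv0 : 0 ≤ v := hu.trans huv
      have e := hf.add_grad_le hv0 hu
      -- Only free variables have moved, so the tangent inequality at `v` gives `f v ≤ f u`: a jump
      -- costs nothing and takes no time.
      have : (u - v) ⬝ᵥ orthantGrad f v = 0 := by
        refine Finset.sum_eq_zero fun j _ => ?_
        by_cases hj : 0 < a j ∧ IsFree f j
        · rw [hj.2 v hv0, mul_zero]
        · rw [Pi.sub_apply, hfix j hj, sub_self, zero_mul]
      linarith
    · intro z w hz hw δ N c hδ hN _
      rw [mul_zero, sub_nonneg]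
      exact coveringPotential_mono (fun j => hf.grad_nonneg (hu.trans (huv.trans hz)) j)
        hw hδ hN hu huv

end Round

theorem Fin.sum_succ_sub_castSucc {m : ℕ} (h : Fin (m + 1) → ℝ) :
    ∑ i : Fin m, (h i.succ - h i.castSucc) = h (Fin.last m) - h 0 := by
  have h1 := Fin.sum_univ_castSucc h
  have h2 := Fin.sum_univ_succ h
  rw [Finset.sum_sub_distrib]
  linarith

/-! ### Summing over the rounds -/

section Run

variable {m n d : ℕ} {f : (Fin n → ℝ) → ℝ} {p lam : ℝ} {x' : Fin n → ℝ}
  {A : Matrix (Fin m) (Fin n) ℝ} {x : Fin (m + 1) → Fin n → ℝ}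

theorem IsPDLARun.monotone (hx : IsPDLARun f d lam x' A x)
    (hf : IsCoveringObjective f) (hp : IsGrowthExponent f p)
    (hx' : 0 ≤ x') (h0 : 0 ≤ lam) (h1 : lam ≤ 1) (hA : IsCoveringMatrix A) : Monotone x :=
  Fin.monotone_iff_le_succ.2 fun i => ((hx.2 i).le_and_cover hf hp hx' h0 h1 (hA.1 i)).1

theorem IsPDLARun.nonneg (hx : IsPDLARun f d lam x' A x)
    (hf : IsCoveringObjective f) (hp : IsGrowthExponent f p)
    (hx' : 0 ≤ x') (h0 : 0 ≤ lam) (h1 : lam ≤ 1) (hA : IsCoveringMatrix A) (k : Fin (m + 1)) :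
    0 ≤ x k := by
  rw [← hx.1]
  exact hx.monotone hf hp hx' h0 h1 hA (Fin.zero_le k)

theorem card_pos_le_rowSparsity (hd : rowSparsity A = d) (i : Fin m) :
    (Finset.univ.filter fun j => 0 < A i j).card ≤ d := by
  rw [← hd]
  exact Finset.le_sup (f := fun i => (Finset.univ.filter fun j => 0 < A i j).card)
    (Finset.mem_univ i)

/-- All rounds use the gradient at the final solution as weights, so the potential is the same
function throughout and its increments telescope. Each row may have its own rate `c i`, and `c i =
0` leaves a row uncharged. -/
theorem IsPDLARun.exists_times (hx : IsPDLARun f d lam x' A x)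
    (hf : IsCoveringObjective f) (hp : IsGrowthExponent f p)
    (hx' : 0 ≤ x') (h0 : 0 ≤ lam) (h1 : lam ≤ 1) (hA : IsCoveringMatrix A)
    (hd : rowSparsity A = d) :
    ∃ y : Fin m → ℝ, 0 ≤ y ∧ f (x (Fin.last m)) ≤ 2 * ∑ i, y i ∧
      ∀ w : Fin n → ℝ, 0 ≤ w → ∀ δ N : ℝ, 0 < δ → δ ≤ N → ∀ c : Fin m → ℝ,
      (∀ i z, 0 ≤ z → A i ⬝ᵥ z < 1 → c i ≤ potentialRate d lam x' (A i) w δ N z) →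
      ∑ i, c i * y i ≤
        Real.log (N / δ) * (w ⬝ᵥ orthantGrad f (x (Fin.last m))) := by
  have hmono := hx.monotone hf hp hx' h0 h1 hA
  have hnn := hx.nonneg hf hp hx' h0 h1 hA
  choose y hy0 hy1 hy2 using fun i => (hx.2 i).exists_time hf hp hx' h0 h1 (hA.1 i) (card_pos_le_rowSparsity hd i)
    (hnn i.castSucc)
  refine ⟨y, hy0, ?_, fun w hw δ N hδ hN c hc => ?_⟩
  · have h2 := Fin.sum_succ_sub_castSucc fun k => f (x k)
    simp only [hx.1, hf.map_zero, sub_zero] at h2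
    rw [← h2, Finset.mul_sum]
    exact Finset.sum_le_sum fun i _ => hy1 i
  · have hg : 0 ≤ orthantGrad f (x (Fin.last m)) := fun j => hf.grad_nonneg (hnn _) j
    have h2 := Fin.sum_succ_sub_castSucc fun k =>
      coveringPotential (orthantGrad f (x (Fin.last m))) w δ N (x k)
    simp only [hx.1] at h2
    refine le_trans ?_ (coveringPotential_sub_le hg hw hδ hN (hnn (Fin.last m)))
    rw [← h2]
    exact Finset.sum_le_sum fun i _ =>
      hy2 i _ w (hmono (Fin.le_last _)) hw δ N (c i) hδ hN (hc i)

theorem exists_pos_of_isCoveringMatrix (hA : IsCoveringMatrix A) (i : Fin m) :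
    ∃ j, 0 < A i j := by
  obtain ⟨z, hz0, hz⟩ := hA.2
  by_contra hc
  push Not at hc
  have : A i ⬝ᵥ z = 0 :=
    Finset.sum_eq_zero fun j _ => by rw [le_antisymm (hc j) (hA.1 i j), zero_mul]
  linarith [hz i]

theorem one_le_rowSparsity (hA : IsCoveringMatrix A) (hd : rowSparsity A = d) (i : Fin m) :
    1 ≤ d := by
  obtain ⟨j, hj⟩ := exists_pos_of_isCoveringMatrix hA i
  exact le_trans (Finset.card_pos.2 ⟨j, by simp [hj]⟩) (card_pos_le_rowSparsity hd i)

end Run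

theorem le_add_mul_coveringOPT {m n : ℕ} {f : (Fin n → ℝ) → ℝ} {A : Matrix (Fin m) (Fin n) ℝ}
    (hA : IsCoveringMatrix A) {b r c : ℝ} (hc : 0 ≤ c)
    (h : ∀ z, IsCover A z → b ≤ r + c * f z) : b ≤ r + c * coveringOPT f A := by
  obtain ⟨z₀, hz₀⟩ := hA.2
  rcases hc.eq_or_lt with h0 | h0
  · have := h z₀ hz₀
    rw [← h0, zero_mul] at this ⊢
    exact this
  · have : (b - r) / c ≤ coveringOPT f A := by
      refine le_csInf ⟨_, mem_image_of_mem f hz₀⟩ ?_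
      rintro _ ⟨z, hz, rfl⟩
      rw [div_le_iff₀ h0]
      linarith [h z hz]
    rw [div_le_iff₀ h0] at this
    linarith

theorem half_le_log {y : ℝ} (hy : 2 ≤ y) : 1 / 2 ≤ Real.log y := by
  have h1 := Real.log_two_gt_d9
  have h2 := Real.log_le_log two_pos hy
  linarith

/-- The argument equals `4 λ (d/λ)²`, at most `4 D²`, hence at most `D⁴` since `D ≥ 2`. -/
theorem log_four_mul_sq_div_le {d lam D : ℝ} (hd : 0 < d) (hlam : 0 < lam) (hlam1 : lam ≤ 1)
    (hD : 2 ≤ D) (hdD : d / lam ≤ D) : Real.log (4 * d / (lam / d)) ≤ 4 * Real.log D := by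
  have h1 : 4 * d / (lam / d) ≤ D ^ 4 := by
    have e1 : 4 * d / (lam / d) = 4 * (lam * (d / lam) ^ 2) := by field_simp
    have e2 : 0 ≤ d / lam := by positivity
    have e3 : (d / lam) ^ 2 ≤ D ^ 2 := pow_le_pow_left₀ e2 hdD 2
    have e4 : lam * (d / lam) ^ 2 ≤ 1 * D ^ 2 := mul_le_mul hlam1 e3 (by positivity) zero_le_one
    rw [e1]
    nlinarith [mul_nonneg (sq_nonneg D) (by nlinarith : 0 ≤ D ^ 2 - 4)]
  calc _ ≤ Real.log (D ^ 4) := Real.log_le_log (by positivity) h1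
    _ = _ := by rw [Real.log_pow]; norm_num

/-- The loss of the algorithm with respect to the advice. -/
noncomputable def adviceLoss (p : ℝ) : ℝ := 4 * (32 * p ^ 2) ^ p

theorem adviceLoss_nonneg (p : ℝ) : 0 ≤ adviceLoss p := by
  unfold adviceLoss
  positivity

/-- From `log y ≤ p y^(1/p)` with `y = 4/κ`: the `p`-th power of the logarithm costs only one factor
`1/κ` and a constant depending on `p`. -/
theorem rpow_log_le_adviceLoss {p κ : ℝ} (hp : 1 ≤ p) (hκ : 0 < κ) (hκ1 : κ ≤ 1) :
    (32 * Real.log (4 / κ) * p) ^ p ≤ adviceLoss p / κ := by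
  have hp0 : 0 < p := by linarith
  have h4 : 2 ≤ 4 / κ := by rw [le_div_iff₀ hκ]; linarith
  have h1 : Real.log (4 / κ) ≤ (4 / κ) ^ (1 / p) / (1 / p) :=
    Real.log_le_rpow_div (by positivity) (by positivity)
  have h0 := half_le_log h4
  have h2 : 32 * Real.log (4 / κ) * p ≤ 32 * p ^ 2 * (4 / κ) ^ (1 / p) := by
    have := mul_le_mul_of_nonneg_left h1 hp0.le
    have e : p * ((4 / κ) ^ (1 / p) / (1 / p)) = p ^ 2 * (4 / κ) ^ (1 / p) := by field_simp
    rw [e] at this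
    linarith
  calc (32 * Real.log (4 / κ) * p) ^ p
      ≤ (32 * p ^ 2 * (4 / κ) ^ (1 / p)) ^ p := Real.rpow_le_rpow (by positivity) h2 hp0.le
    _ = (32 * p ^ 2) ^ p * (4 / κ) := by
      rw [Real.mul_rpow (by positivity) (by positivity), ← Real.rpow_mul (by positivity),
        one_div_mul_cancel hp0.ne', Real.rpow_one]
    _ = adviceLoss p / κ := by unfold adviceLoss; ring

/-! ### Robustness and consistency -/

section Competitive

variable {m n d : ℕ} {f : (Fin n → ℝ) → ℝ} {p lam : ℝ} {x' : Fin n → ℝ}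
  {A : Matrix (Fin m) (Fin n) ℝ} {x : Fin (m + 1) → Fin n → ℝ}

/-- Every `D_j` is at least `λ/(a_j d)`, whatever the advice, so each row pays at rate `1/4` into
the potential of `z` with `δ = λ/d`. -/
theorem IsPDLARun.robust (hx : IsPDLARun f d lam x' A x)
    (hf : IsCoveringObjective f) (hp : IsGrowthExponent f p) (hp1 : 1 ≤ p)
    (hx' : 0 ≤ x') (h0 : 0 < lam) (h1 : lam ≤ 1) (hA : IsCoveringMatrix A)
    (hd : rowSparsity A = d) {z : Fin n → ℝ} (hz : IsCover A z) :
    f (x (Fin.last m)) ≤ (64 * Real.log (max (d : ℝ) 2 / lam) * p) ^ p * f z := by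
  obtain ⟨y, hy0, hy1, hy2⟩ := hx.exists_times hf hp hx' h0.le h1 hA hd
  have hnn := hx.nonneg hf hp hx' h0.le h1 hA (Fin.last m)
  set g := orthantGrad f (x (Fin.last m)) with hg
  have hzg : 0 ≤ z ⬝ᵥ g := dotProduct_nonneg_of_nonneg hz.1 fun j => hf.grad_nonneg hnn j
  have hD : 2 ≤ max (d : ℝ) 2 / lam := by
    rw [le_div_iff₀ h0]
    exact le_trans (by linarith) (le_max_right _ _)
  have hlog := half_le_log hD
  refine hf.le_rpow_mul_of_le_dotProduct_grad hp hp1 hnn hz.1 (by nlinarith) ?_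
  rcases isEmpty_or_nonempty (Fin m) with hm | ⟨⟨i₀⟩⟩
  · refine hy1.trans ?_
    rw [Finset.univ_eq_empty, Finset.sum_empty, mul_zero]
    positivity
  · have hd1 := one_le_rowSparsity hA hd i₀
    have hd1' : (1 : ℝ) ≤ d := by exact_mod_cast hd1
    have hd0 : (0 : ℝ) < d := by linarith
    have hδ1 : lam / d ≤ 1 := div_le_one_of_le₀ (by linarith) hd0.le
    have := hy2 z hz.1 (lam / d) (4 * d) (by positivity) (by linarith) (fun _ => 1 / 4)
      fun i w hw hw1 => le_potentialRate_of_cover hx' h0.le h1 (hA.1 i) hw hz.1 (hz.2 i) hw1.le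
        hd1 h0 h1 fun j _ => le_growthTerm hx' h1 (hA.1 i) j
    rw [← Finset.mul_sum] at this
    have hl := log_four_mul_sq_div_le (D := max (d : ℝ) 2 / lam) hd0 h0 h1 hD
      (by gcongr; exact le_max_left _ _)
    have := mul_le_mul_of_nonneg_right hl hzg
    have : 0 ≤ Real.log (max (d : ℝ) 2 / lam) * (z ⬝ᵥ g) := by positivity
    linarith

/-- Rows satisfied by the advice are charged to the potential of `x'` at rate `1/8`; the remaining
rows use `D_j = 1/(a_j d)` and are charged to that of `z` at rate `1/4`, free of `λ`. -/
theorem IsPDLARun.advice_times (hx : IsPDLARun f d lam x' A x)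
    (hf : IsCoveringObjective f) (hp : IsGrowthExponent f p)
    (hx' : 0 ≤ x') (h0 : 0 ≤ lam) (h1 : lam < 1) (hA : IsCoveringMatrix A)
    (hd : rowSparsity A = d) {z : Fin n → ℝ} (hz : IsCover A z) :
    f (x (Fin.last m)) ≤
      16 * Real.log (4 / (1 - lam)) * (x' ⬝ᵥ orthantGrad f (x (Fin.last m))) +
      32 * Real.log (max (d : ℝ) 2) * (z ⬝ᵥ orthantGrad f (x (Fin.last m))) := by
  classical
  obtain ⟨y, hy0, hy1, hy2⟩ := hx.exists_times hf hp hx' h0 h1.le hA hd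
  have hnn := hx.nonneg hf hp hx' h0 h1.le hA (Fin.last m)
  set g := orthantGrad f (x (Fin.last m)) with hg
  have hg0 : 0 ≤ g := fun j => hf.grad_nonneg hnn j
  have hzg : 0 ≤ z ⬝ᵥ g := dotProduct_nonneg_of_nonneg hz.1 hg0
  have hxg : 0 ≤ x' ⬝ᵥ g := dotProduct_nonneg_of_nonneg hx' hg0
  have hκ0 : 0 < 1 - lam := by linarith
  have hD : 2 ≤ max (d : ℝ) 2 := le_max_right _ _
  have hlog := half_le_log hD
  have hlog' : 1 / 2 ≤ Real.log (4 / (1 - lam)) :=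
    half_le_log (by rw [le_div_iff₀ hκ0]; linarith)
  have b1 := hy2 x' hx' (1 - lam) 4 hκ0 (by linarith) (fun i => if 1 ≤ A i ⬝ᵥ x' then 1 / 8 else 0)
    (by
      intro i w hw hw1
      split_ifs with hi
      · exact le_potentialRate_of_advice hx' h0 h1 (hA.1 i) hw hi hw1.le
      · exact potentialRate_nonneg hx' h0 h1.le (hA.1 i) hw hx' hκ0 (by linarith))
  rcases isEmpty_or_nonempty (Fin m) with hm | ⟨⟨i₀⟩⟩
  · refine hy1.trans ?_
    rw [Finset.univ_eq_empty, Finset.sum_empty, mul_zero]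
    positivity
  · have hd1 := one_le_rowSparsity hA hd i₀
    have hd1' : (1 : ℝ) ≤ d := by exact_mod_cast hd1
    have hd0 : (0 : ℝ) < d := by linarith
    have hδ1 : 1 / (d : ℝ) ≤ 1 := div_le_one_of_le₀ hd1' hd0.le
    have b2 := hy2 z hz.1 (1 / d) (4 * d) (by positivity) (by linarith)
      (fun i => if 1 ≤ A i ⬝ᵥ x' then 0 else 1 / 4)
      (by
        intro i w hw hw1
        split_ifs with hi
        · exact potentialRate_nonneg hx' h0 h1.le (hA.1 i) hw hz.1 (by positivity) (by linarith)
        · refine le_potentialRate_of_cover hx' h0 h1.le (hA.1 i) hw hz.1 (hz.2 i) hw1.le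
            hd1 one_pos le_rfl fun j _ => ?_
          simp only [growthTerm, hi, if_false, le_refl])
    have hl := log_four_mul_sq_div_le (D := max (d : ℝ) 2) hd0 one_pos le_rfl hD
      (by rw [div_one]; exact le_max_left _ _)
    have := mul_le_mul_of_nonneg_right hl hzg
    have hsum : ∑ i, y i = 8 * ∑ i, (if 1 ≤ A i ⬝ᵥ x' then 1 / 8 else 0) * y i +
        4 * ∑ i, (if 1 ≤ A i ⬝ᵥ x' then 0 else 1 / 4) * y i := by
      rw [Finset.mul_sum, Finset.mul_sum, ← Finset.sum_add_distrib]
      refine Finset.sum_congr rfl fun i _ => ?_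
      split_ifs <;> ring
    rw [hsum] at hy1
    linarith

/-- One of the two summands in `advice_times` is at least half of `f(x̄)`; the doubled constants
come from this choice. -/
theorem IsPDLARun.le_advice_or (hx : IsPDLARun f d lam x' A x)
    (hf : IsCoveringObjective f) (hp : IsGrowthExponent f p) (hp1 : 1 ≤ p)
    (hx' : 0 ≤ x') (h0 : 0 ≤ lam) (h1 : lam < 1) (hA : IsCoveringMatrix A)
    (hd : rowSparsity A = d) {z : Fin n → ℝ} (hz : IsCover A z) :
    f (x (Fin.last m)) ≤ adviceLoss p / (1 - lam) * f x' ∨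
      f (x (Fin.last m)) ≤ (64 * Real.log (max (d : ℝ) 2) * p) ^ p * f z := by
  have hnn := hx.nonneg hf hp hx' h0 h1.le hA (Fin.last m)
  have hκ0 : 0 < 1 - lam := by linarith
  have hlog := half_le_log (le_max_right (d : ℝ) 2)
  have hlog' : 1 / 2 ≤ Real.log (4 / (1 - lam)) :=
    half_le_log (by rw [le_div_iff₀ hκ0]; linarith)
  have h := hx.advice_times hf hp hx' h0 h1 hA hd hz
  rcases le_or_gt (f (x (Fin.last m)))
    (32 * Real.log (4 / (1 - lam)) * (x' ⬝ᵥ orthantGrad f (x (Fin.last m)))) with h2 | h2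
  · refine Or.inl ((hf.le_rpow_mul_of_le_dotProduct_grad hp hp1 hnn hx' (by nlinarith) h2).trans ?_)
    exact mul_le_mul_of_nonneg_right (rpow_log_le_adviceLoss hp1 hκ0 (by linarith))
      (hf.nonneg hx')
  · refine Or.inr (hf.le_rpow_mul_of_le_dotProduct_grad hp hp1 hnn hz.1 (by nlinarith) ?_)
    linarith

theorem IsPDLARun.consistent (hx : IsPDLARun f d lam x' A x)
    (hf : IsCoveringObjective f) (hp : IsGrowthExponent f p) (hp1 : 1 ≤ p)
    (hx' : IsCover A x') (h0 : 0 ≤ lam) (h1 : lam < 1) (hA : IsCoveringMatrix A)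
    (hd : rowSparsity A = d) :
    f (x (Fin.last m)) ≤ adviceLoss p / (1 - lam) * f x' := by
  obtain ⟨y, hy0, hy1, hy2⟩ := hx.exists_times hf hp hx'.1 h0 h1.le hA hd
  have hnn := hx.nonneg hf hp hx'.1 h0 h1.le hA (Fin.last m)
  have hκ0 : 0 < 1 - lam := by linarith
  have hlog' : 1 / 2 ≤ Real.log (4 / (1 - lam)) :=
    half_le_log (by rw [le_div_iff₀ hκ0]; linarith)
  have hxg : 0 ≤ x' ⬝ᵥ orthantGrad f (x (Fin.last m)) :=
    dotProduct_nonneg_of_nonneg hx'.1 fun j => hf.grad_nonneg hnn j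
  have b1 := hy2 x' hx'.1 (1 - lam) 4 hκ0 (by linarith) (fun _ => 1 / 8)
    fun i w hw hw1 => le_potentialRate_of_advice hx'.1 h0 h1 (hA.1 i) hw (hx'.2 i) hw1.le
  rw [← Finset.mul_sum] at b1
  have h3 : 0 ≤ Real.log (4 / (1 - lam)) * (x' ⬝ᵥ orthantGrad f (x (Fin.last m))) := by positivity
  refine (hf.le_rpow_mul_of_le_dotProduct_grad hp hp1 hnn hx'.1
    (Q := 32 * Real.log (4 / (1 - lam))) (by nlinarith) (by linarith)).trans ?_
  exact mul_le_mul_of_nonneg_right (rpow_log_le_adviceLoss hp1 hκ0 (by linarith))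
    (hf.nonneg hx'.1)

theorem coveringOPT_nonneg (hf : IsCoveringObjective f) : 0 ≤ coveringOPT f A := by
  refine Real.sInf_nonneg ?_
  rintro _ ⟨z, hz, rfl⟩
  exact hf.nonneg hz.1

theorem IsPDLARun.bounds (hx : IsPDLARun f d lam x' A x)
    (hf : IsCoveringObjective f) (hp : IsGrowthExponent f p)
    (hx' : 0 ≤ x') (h0 : 0 ≤ lam) (h1 : lam ≤ 1) (hA : IsCoveringMatrix A)
    (hd : rowSparsity A = d) :
    (lam < 1 → f (x (Fin.last m)) ≤ adviceLoss p / (1 - lam) * f x' +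
      (64 * (p * Real.log (max (d : ℝ) 2))) ^ p * coveringOPT f A) ∧
    (0 < lam → f (x (Fin.last m)) ≤
      (64 * (p * Real.log (max (d : ℝ) 2 / lam))) ^ p * coveringOPT f A) ∧
    (lam < 1 → IsCover A x' → f (x (Fin.last m)) ≤ adviceLoss p / (1 - lam) * f x') := by
  have hnn := hx.nonneg hf hp hx' h0 h1 hA (Fin.last m)
  have hp0 : 0 ≤ p := IsCoveringObjective.growthExponent_nonneg hp
  have hK := adviceLoss_nonneg p
  have hfx := hf.nonneg hx'
  have hO : 0 ≤ coveringOPT f A := coveringOPT_nonneg hf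
  have hlog := half_le_log (le_max_right (d : ℝ) 2)
  have hlog' : 0 < lam → 1 / 2 ≤ Real.log (max (d : ℝ) 2 / lam) := fun hl => half_le_log (by
    rw [le_div_iff₀ hl]
    exact le_trans (by linarith) (le_max_right _ _))
  have hc1 : 0 ≤ (64 * (p * Real.log (max (d : ℝ) 2))) ^ p :=
    Real.rpow_nonneg (by positivity) _
  have hc2 : 0 < lam → 0 ≤ (64 * (p * Real.log (max (d : ℝ) 2 / lam))) ^ p := fun hl => by
    have := hlog' hl
    exact Real.rpow_nonneg (by positivity) _
  have hc3 : lam < 1 → 0 ≤ adviceLoss p / (1 - lam) * f x' := fun hl => by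
    have : 0 < 1 - lam := by linarith
    positivity
  -- When `f` vanishes identically, `p` may be below `1`, and the bounds hold because their
  -- right-hand sides are nonnegative.
  rcases hf.eq_zero_or_one_le hp with hz | hp1
  · rw [hz _ hnn]
    exact ⟨fun hl => add_nonneg (hc3 hl) (mul_nonneg hc1 hO), fun hl => mul_nonneg (hc2 hl) hO,
      fun hl _ => hc3 hl⟩
  · refine ⟨fun hl => ?_, fun hl => ?_, fun hl hc => hx.consistent hf hp hp1 hc h0 hl hA hd⟩
    · refine le_add_mul_coveringOPT hA hc1 fun z hz => ?_
      have hz0 := mul_nonneg hc1 (hf.nonneg hz.1)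
      rcases hx.le_advice_or hf hp hp1 hx' h0 hl hA hd hz with h | h
      · linarith
      · rw [mul_assoc, mul_comm _ p] at h
        linarith [hc3 hl]
    · rw [← zero_add ((64 * (p * Real.log (max (d : ℝ) 2 / lam))) ^ p * coveringOPT f A)]
      refine le_add_mul_coveringOPT hA (hc2 hl) fun z hz => ?_
      have h := hx.robust hf hp hp1 hx' hl h1 hA hd hz
      rw [mul_assoc, mul_comm _ p] at h
      linarith

end Competitive

/-- The Euler scheme of step `h` for the vector field `F`. -/
def eulerSeq {n : ℕ} (F : (Fin n → ℝ) → Fin n → ℝ) (h : ℝ) (z : Fin n → ℝ) (i : ℕ) : Fin n → ℝ :=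
  (fun x => x + h • F x)^[i] z

theorem eulerSeq_succ {n : ℕ} (F : (Fin n → ℝ) → Fin n → ℝ) (h : ℝ) (z : Fin n → ℝ) (i : ℕ)
    (j : Fin n) :
    eulerSeq F h z (i + 1) j = eulerSeq F h z i j + h * F (eulerSeq F h z i) j := by
  simp [eulerSeq, Function.iterate_succ_apply']

/-- The vector field `F` vanishes outside the coordinates `J`; on the states above `u` which are
positive on `J`, its coordinates in `J` are bounded below by `c`, and bounded above where the
coordinate in question is bounded away from `0`. -/
structure IsGrowthField {n : ℕ} (F : (Fin n → ℝ) → Fin n → ℝ) (u : Fin n → ℝ) (J : Set (Fin n))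
    (c : ℝ) : Prop where
  nonneg : 0 ≤ u
  pos : 0 < c
  zero : ∀ x, ∀ j ∉ J, F x j = 0
  lower : ∀ x, u ≤ x → (∀ i ∈ J, 0 < x i) → ∀ j ∈ J, c ≤ F x j
  upper : ∀ η : ℝ, 0 < η → ∃ K : ℝ, ∀ x, u ≤ x → (∀ i ∈ J, 0 < x i) → ∀ j ∈ J, η ≤ x j → F x j ≤ K

/-! ### Euler schemes for singular, discontinuous growth fields -/

namespace IsGrowthField

variable {n : ℕ} {F : (Fin n → ℝ) → Fin n → ℝ} {u z : Fin n → ℝ} {J : Set (Fin n)} {c h ε : ℝ}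

theorem eulerSeq_notMem (hF : IsGrowthField F u J c) {j : Fin n} (hj : j ∉ J) (i : ℕ) :
    eulerSeq F h z i j = z j := by
  induction i with
  | zero => rfl
  | succ i ih => rw [eulerSeq_succ, ih, hF.zero _ j hj, mul_zero, add_zero]

theorem eulerSeq_region (hF : IsGrowthField F u J c) (hh : 0 < h) (hε : 0 < ε) (hz : u ≤ z)
    (hzJ : ∀ j ∈ J, u j + ε ≤ z j) (i : ℕ) :
    u ≤ eulerSeq F h z i ∧ ∀ j ∈ J, u j + ε ≤ eulerSeq F h z i j := by
  induction i with
  | zero => exact ⟨hz, hzJ⟩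
  | succ i ih =>
    have hpos : ∀ j ∈ J, 0 < eulerSeq F h z i j := fun j hj => by
      have : 0 ≤ u j := hF.nonneg j
      linarith [ih.2 j hj]
    have hJ : ∀ j ∈ J, u j + ε ≤ eulerSeq F h z (i + 1) j := fun j hj => by
      rw [eulerSeq_succ]
      have := hF.lower _ ih.1 hpos j hj
      have := mul_nonneg hh.le (hF.pos.le.trans this)
      linarith [ih.2 j hj]
    refine ⟨fun j => ?_, hJ⟩
    by_cases hj : j ∈ J
    · linarith [hJ j hj]
    · rw [hF.eulerSeq_notMem hj]
      exact hz j

theorem eulerSeq_pos (hF : IsGrowthField F u J c) (hh : 0 < h) (hε : 0 < ε) (hz : u ≤ z)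
    (hzJ : ∀ j ∈ J, u j + ε ≤ z j) (i : ℕ) : ∀ j ∈ J, 0 < eulerSeq F h z i j := fun j hj => by
  have : 0 ≤ u j := hF.nonneg j
  linarith [(hF.eulerSeq_region hh hε hz hzJ i).2 j hj]

theorem eulerSeq_lower (hF : IsGrowthField F u J c) (hh : 0 < h) (hε : 0 < ε) (hz : u ≤ z)
    (hzJ : ∀ j ∈ J, u j + ε ≤ z j) {j : Fin n} (hj : j ∈ J) {i k : ℕ} (hik : i ≤ k) :
    eulerSeq F h z i j + c * (h * k - h * i) ≤ eulerSeq F h z k j := by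
  induction k, hik using Nat.le_induction with
  | base => simp
  | succ k _ ih =>
    rw [eulerSeq_succ]
    have := hF.lower _ (hF.eulerSeq_region hh hε hz hzJ k).1 (hF.eulerSeq_pos hh hε hz hzJ k) j hj
    have := mul_le_mul_of_nonneg_left this hh.le
    push_cast
    linarith

theorem eulerSeq_mono (hF : IsGrowthField F u J c) (hh : 0 < h) (hε : 0 < ε) (hz : u ≤ z)
    (hzJ : ∀ j ∈ J, u j + ε ≤ z j) : Monotone (eulerSeq F h z) := by
  intro i k hik j
  by_cases hj : j ∈ J
  · have h1 := hF.eulerSeq_lower hh hε hz hzJ hj hik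
    have h2 : (i : ℝ) ≤ k := by exact_mod_cast hik
    have h3 : 0 ≤ c * (h * k - h * i) :=
      mul_nonneg hF.pos.le (by rw [← mul_sub]; exact mul_nonneg hh.le (by linarith))
    linarith
  · rw [hF.eulerSeq_notMem hj, hF.eulerSeq_notMem hj]

/-- Above the level `η` the speed is at most `K`. Below it the field may be large, but a single step
has size at most `ε`, so the scheme overshoots `η` by at most `ε`. -/
theorem eulerSeq_upper (hF : IsGrowthField F u J c) (hh : 0 < h) (hε : 0 < ε) (hz : u ≤ z)
    (hzJ : ∀ j ∈ J, u j + ε ≤ z j) {K₀ η K : ℝ}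
    (hK₀ : ∀ x, u ≤ x → (∀ i ∈ J, 0 < x i) → ∀ j ∈ J, ε ≤ x j → F x j ≤ K₀) (hhK : h * K₀ ≤ ε)
    (hK0 : 0 ≤ K) (hK : ∀ x, u ≤ x → (∀ i ∈ J, 0 < x i) → ∀ j ∈ J, η ≤ x j → F x j ≤ K)
    {j : Fin n} (hj : j ∈ J) {i k : ℕ} (hik : i ≤ k) :
    eulerSeq F h z k j ≤ max (eulerSeq F h z i j) η + ε + K * (h * k - h * i) := by
  induction k, hik using Nat.le_induction with
  | base =>
    rw [sub_self, mul_zero, add_zero]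
    exact (le_max_left _ _).trans (by linarith)
  | succ k hik ih =>
    rw [eulerSeq_succ]
    have hreg := hF.eulerSeq_region hh hε hz hzJ k
    have hpos := hF.eulerSeq_pos hh hε hz hzJ k
    have hKh : 0 ≤ K * h := mul_nonneg hK0 hh.le
    push_cast
    rcases le_or_gt η (eulerSeq F h z k j) with h1 | h1
    · have := mul_le_mul_of_nonneg_left (hK _ hreg.1 hpos j hj h1) hh.le
      linarith
    · have h2 : ε ≤ eulerSeq F h z k j := by
        have : 0 ≤ u j := hF.nonneg j
        linarith [hreg.2 j hj]
      have := mul_le_mul_of_nonneg_left (hK₀ _ hreg.1 hpos j hj h2) hh.le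
      have h3 : (i : ℝ) ≤ k := by exact_mod_cast hik
      have h4 : 0 ≤ K * (h * (k + 1) - h * i) :=
        mul_nonneg hK0 (by rw [← mul_sub]; exact mul_nonneg hh.le (by linarith))
      linarith [le_max_right (eulerSeq F h z i j) η]

end IsGrowthField

theorem eulerSeq_approx {n : ℕ} {F : (Fin n → ℝ) → Fin n → ℝ} {h e v : ℝ} {z : Fin n → ℝ}
    (hh : 0 < h) {j : Fin n} {i k : ℕ} (hik : i ≤ k)
    (hF : ∀ l, i ≤ l → l < k → |F (eulerSeq F h z l) j - v| ≤ e) :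
    |eulerSeq F h z k j - eulerSeq F h z i j - (h * k - h * i) * v| ≤ e * (h * k - h * i) := by
  induction k, hik using Nat.le_induction with
  | base => simp
  | succ k hik ih =>
    have h1 := ih fun l hl hlk => hF l hl (hlk.trans (Nat.lt_succ_self k))
    have h2 := hF k hik (Nat.lt_succ_self k)
    rw [eulerSeq_succ]
    push_cast
    rw [abs_le] at h1 h2 ⊢
    constructor <;> nlinarith [mul_le_mul_of_nonneg_left h2.1 hh.le,
      mul_le_mul_of_nonneg_left h2.2 hh.le]

theorem exists_tendsto_of_mem_Icc {ι : Type*} (U : Ultrafilter ι) {y : ι → ℝ} {a b : ℝ}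
    (h : ∀ i, y i ∈ Icc a b) : ∃ l, Tendsto y U (𝓝 l) := by
  obtain ⟨l, -, hl⟩ := (isCompact_Icc (a := a) (b := b)).ultrafilter_le_nhds (U.map y)
    (tendsto_principal.2 (Eventually.of_forall h))
  exact ⟨l, hl⟩

theorem mul_floor_bounds {h t : ℝ} (hh : 0 < h) (ht : 0 ≤ t) :
    h * ⌊t / h⌋₊ ≤ t ∧ t - h ≤ h * ⌊t / h⌋₊ := by
  have h1 := Nat.floor_le (div_nonneg ht hh.le)
  have h2 := Nat.lt_floor_add_one (t / h)
  rw [le_div_iff₀ hh] at h1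
  rw [div_lt_iff₀ hh] at h2
  constructor <;> linarith

theorem hasDerivAt_of_forall_abs_le {y : ℝ → ℝ} {v t : ℝ}
    (h : ∀ e > 0, ∃ r > 0, ∀ s s', t - r ≤ s → s ≤ s' → s' ≤ t + r →
      |y s' - y s - (s' - s) * v| ≤ e * (s' - s)) : HasDerivAt y v t := by
  rw [hasDerivAt_iff_isLittleO, Asymptotics.isLittleO_iff]
  intro e he
  obtain ⟨r, hr, H⟩ := h e he
  filter_upwards [Icc_mem_nhds (by linarith : t - r < t) (by linarith : t < t + r)] with s hs
  rw [Real.norm_eq_abs, Real.norm_eq_abs, smul_eq_mul]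
  rcases le_total s t with hst | hst
  · have := H s t hs.1 hst (by linarith)
    rw [abs_of_nonpos (by linarith : s - t ≤ 0), ← abs_neg]
    convert this using 2 <;> ring
  · have := H t s (by linarith) hst hs.2
    rwa [abs_of_nonneg (by linarith : 0 ≤ s - t)]

/-- Euler schemes started at `u + ε` on `J` converge pointwise along an ultrafilter as `ε → 0`. The
lower speed bound and the overshoot estimate pass to the limit and make it continuous even where the
field is unbounded; the equation is recovered at every time at which the field is continuous at the
limit point. -/
theorem IsGrowthField.exists_path {n : ℕ} {F : (Fin n → ℝ) → Fin n → ℝ} {u : Fin n → ℝ}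
    {J : Set (Fin n)} {c : ℝ} (hF : IsGrowthField F u J c) :
    ∃ X : ℝ → Fin n → ℝ, X 0 = u ∧ ContinuousOn X (Ici 0) ∧ (∀ t, ∀ j ∉ J, X t j = u j) ∧
      (∀ j ∈ J, ∀ s t, 0 ≤ s → s ≤ t → X s j + c * (t - s) ≤ X t j) ∧
      ∀ t, 0 < t → ContinuousAt F (X t) → ∀ j, HasDerivAt (fun s => X s j) (F (X t) j) t := by
  classical
  have hup' : ∀ η : ℝ, 0 < η → ∃ K : ℝ, 0 ≤ K ∧
      ∀ x, u ≤ x → (∀ i ∈ J, 0 < x i) → ∀ j ∈ J, η ≤ x j → F x j ≤ K := by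
    intro η hη
    obtain ⟨K, hK⟩ := hF.upper η hη
    exact ⟨max K 0, le_max_right _ _, fun x h1 h2 j hj h3 =>
      (hK x h1 h2 j hj h3).trans (le_max_left _ _)⟩
  choose! K hK0 hK using hup'
  set ε : ℕ → ℝ := fun k => 1 / ((k : ℝ) + 1) with hεdef
  have hε : ∀ k, 0 < ε k := fun k => Nat.one_div_pos_of_nat
  have hε1 : ∀ k, ε k ≤ 1 := fun k => by
    rw [hεdef]
    exact div_le_one_of_le₀ (by linarith [Nat.cast_nonneg (α := ℝ) k]) (by positivity)
  -- The step is small enough that `h * K ε ≤ ε`: on the region `x_j ≥ ε` visited by the scheme, no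
  -- step moves a coordinate of `J` by more than `ε`.
  set h : ℕ → ℝ := fun k => ε k / (1 + K (ε k)) with hhdef
  have hden : ∀ k, 0 < 1 + K (ε k) := fun k => by linarith [hK0 _ (hε k)]
  have hh : ∀ k, 0 < h k := fun k => div_pos (hε k) (hden k)
  have hhε : ∀ k, h k ≤ ε k := fun k => div_le_self (hε k).le (by linarith [hK0 _ (hε k)])
  have hhK : ∀ k, h k * K (ε k) ≤ ε k := fun k => by
    have : h k * (1 + K (ε k)) = ε k := div_mul_cancel₀ _ (hden k).ne'
    linarith [hh k]
  set z : ℕ → Fin n → ℝ := fun k j => if j ∈ J then u j + ε k else u j with hzdef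
  have hz : ∀ k, u ≤ z k := fun k j => by
    simp only [hzdef]
    split_ifs
    exacts [by linarith [hε k], le_rfl]
  have hzJ : ∀ k, ∀ j ∈ J, u j + ε k ≤ z k j := fun k j hj => by simp [hzdef, hj]
  set Y : ℕ → ℝ → Fin n → ℝ := fun k t => eulerSeq F (h k) (z k) ⌊t / h k⌋₊ with hYdef
  have hYout : ∀ k t, ∀ j ∉ J, Y k t j = u j := fun k t j hj => by
    simp only [hYdef]
    rw [hF.eulerSeq_notMem hj]
    simp [hzdef, hj]
  have hYlow : ∀ k, ∀ j ∈ J, ∀ s t, 0 ≤ s → s ≤ t → Y k s j + c * (t - s - ε k) ≤ Y k t j := by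
    intro k j hj s t hs hst
    have h1 := hF.eulerSeq_lower (hh k) (hε k) (hz k) (hzJ k) hj
      (Nat.floor_mono (div_le_div_of_nonneg_right hst (hh k).le))
    have h2 := mul_floor_bounds (hh k) hs
    have h3 := mul_floor_bounds (hh k) (hs.trans hst)
    have h4 : c * (t - s - ε k) ≤ c * (h k * ⌊t / h k⌋₊ - h k * ⌊s / h k⌋₊) :=
      mul_le_mul_of_nonneg_left (by linarith [hhε k]) hF.pos.le
    simp only [hYdef]
    linarith
  have hYup : ∀ η > 0, ∀ k, ∀ j ∈ J, ∀ s t, 0 ≤ s → s ≤ t →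
      Y k t j ≤ max (Y k s j) η + ε k + K η * (t - s + ε k) := by
    intro η hη k j hj s t hs hst
    have h1 := hF.eulerSeq_upper (hh k) (hε k) (hz k) (hzJ k) (hK _ (hε k)) (hhK k)
      (hK0 η hη) (hK η hη) hj (Nat.floor_mono (div_le_div_of_nonneg_right hst (hh k).le))
    have h2 := mul_floor_bounds (hh k) hs
    have h3 := mul_floor_bounds (hh k) (hs.trans hst)
    have h4 : K η * (h k * ⌊t / h k⌋₊ - h k * ⌊s / h k⌋₊) ≤ K η * (t - s + ε k) :=
      mul_le_mul_of_nonneg_left (by linarith [hhε k]) (hK0 η hη)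
    simp only [hYdef]
    linarith
  have hY0 : ∀ k, ∀ j ∈ J, Y k 0 j = u j + ε k := fun k j hj => by
    simp [hYdef, eulerSeq, hzdef, hj]
  -- An ultrafilter gives limits at all times simultaneously, with no extraction of subsequences.
  set U : Ultrafilter ℕ := hyperfilter ℕ with hU
  have hεlim : Tendsto ε U (𝓝 0) :=
    tendsto_one_div_add_atTop_nhds_zero_nat.mono_left Nat.hyperfilter_le_atTop
  have hlim : ∀ t j, ∃ l, 0 ≤ t → Tendsto (fun k => Y k t j) U (𝓝 l) := by
    intro t j
    by_cases ht : 0 ≤ t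
    · by_cases hj : j ∈ J
      · obtain ⟨l, hl⟩ := exists_tendsto_of_mem_Icc U (y := fun k => Y k t j) (a := u j)
          (b := (u j + 1) + 1 + 1 + K 1 * (t + 1)) (by
            intro k
            have e1 := hYup 1 one_pos k j hj 0 t le_rfl ht
            have e2 := hε1 k
            have e3 : K 1 * (t - 0 + ε k) ≤ K 1 * (t + 1) :=
              mul_le_mul_of_nonneg_left (by linarith) (hK0 1 one_pos)
            have e4 : max (Y k 0 j) 1 ≤ (u j + 1) + 1 := by
              have : 0 ≤ u j := hF.nonneg j
              rw [hY0 k j hj]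
              exact max_le (by linarith) (by linarith)
            refine ⟨(hF.eulerSeq_region (hh k) (hε k) (hz k) (hzJ k) _).1 j, ?_⟩
            show Y k t j ≤ _
            linarith)
        exact ⟨l, fun _ => hl⟩
      · exact ⟨u j, fun _ => by simpa only [hYout _ t j hj] using tendsto_const_nhds⟩
    · exact ⟨u j, fun h => absurd h ht⟩
  choose X₀ hX₀ using hlim
  set X : ℝ → Fin n → ℝ := fun t j => if j ∈ J then X₀ t j else u j with hXdef
  have hXout : ∀ t, ∀ j ∉ J, X t j = u j := fun t j hj => by simp [hXdef, hj]
  have hX : ∀ t j, 0 ≤ t → Tendsto (fun k => Y k t j) U (𝓝 (X t j)) := by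
    intro t j ht
    by_cases hj : j ∈ J
    · simpa [hXdef, hj] using hX₀ t j ht
    · simpa only [hYout _ t j hj, hXout t j hj] using tendsto_const_nhds
  have hXlow : ∀ j ∈ J, ∀ s t, 0 ≤ s → s ≤ t → X s j + c * (t - s) ≤ X t j := by
    intro j hj s t hs hst
    have h1 : Tendsto (fun k => Y k s j + c * (t - s - ε k)) U (𝓝 (X s j + c * (t - s - 0))) :=
      (hX s j hs).add ((tendsto_const_nhds.sub hεlim).const_mul c)
    rw [sub_zero] at h1
    exact le_of_tendsto_of_tendsto' h1 (hX t j (hs.trans hst)) fun k => hYlow k j hj s t hs hst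
  have hXup : ∀ η > 0, ∀ j ∈ J, ∀ s t, 0 ≤ s → s ≤ t →
      X t j ≤ max (X s j) η + K η * (t - s) := by
    intro η hη j hj s t hs hst
    have h1 : Tendsto (fun k => max (Y k s j) η + ε k + K η * (t - s + ε k)) U
        (𝓝 (max (X s j) η + 0 + K η * (t - s + 0))) :=
      (((hX s j hs).max tendsto_const_nhds).add hεlim).add
        ((tendsto_const_nhds.add hεlim).const_mul (K η))
    rw [add_zero, add_zero] at h1
    exact le_of_tendsto_of_tendsto' (hX t j (hs.trans hst)) h1 fun k => hYup η hη k j hj s t hs hst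
  have hX0 : X 0 = u := by
    ext j
    by_cases hj : j ∈ J
    · refine tendsto_nhds_unique (hX 0 j le_rfl) ?_
      simp only [hY0 _ j hj]
      simpa using hεlim.const_add (u j)
    · exact hXout 0 j hj
  have hXnn : ∀ j ∈ J, ∀ t, 0 ≤ t → 0 ≤ X t j := by
    intro j hj t ht
    have h1 := hXlow j hj 0 t le_rfl ht
    rw [hX0] at h1
    have h2 : 0 ≤ u j := hF.nonneg j
    have := mul_nonneg hF.pos.le ht
    linarith
  have hcont : ContinuousOn X (Ici 0) := by
    refine continuousOn_pi.2 fun j => ?_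
    by_cases hj : j ∈ J
    · intro t ht
      rw [Metric.continuousWithinAt_iff]
      intro e he
      have hKe := hK0 (e / 2) (half_pos he)
      refine ⟨e / (2 * (K (e / 2) + 1)), by positivity, fun {s} hs hst => ?_⟩
      rw [Real.dist_eq, lt_div_iff₀ (by positivity)] at hst
      have key : ∀ r r', 0 ≤ r → r ≤ r' → |X r' j - X r j| ≤ e / 2 + K (e / 2) * (r' - r) := by
        intro r r' hr hrr
        have h1 := hXup (e / 2) (half_pos he) j hj r r' hr hrr
        have h2 := hXlow j hj r r' hr hrr
        have h3 : max (X r j) (e / 2) ≤ X r j + e / 2 :=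
          max_le (by linarith) (by linarith [hXnn j hj r hr])
        have h4 := mul_nonneg hF.pos.le (sub_nonneg.2 hrr)
        rw [abs_of_nonneg (by linarith)]
        linarith
      rw [Real.dist_eq]
      rcases le_total s t with h1 | h1
      · have h2 := key s t hs h1
        rw [abs_sub_comm] at h2
        rw [abs_of_nonpos (by linarith)] at hst
        nlinarith
      · have h2 := key t s ht h1
        rw [abs_of_nonneg (by linarith)] at hst
        nlinarith
    · simp only [hXout _ j hj]
      exact continuousOn_const
  refine ⟨X, hX0, hcont, hXout, hXlow, fun t ht hFt j => ?_⟩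
  by_cases hj : j ∈ J
  swap
  · simp only [hXout _ j hj, hF.zero _ j hj]
    exact hasDerivAt_const _ _
  refine hasDerivAt_of_forall_abs_le fun e he => ?_
  have hFj : ContinuousAt (fun x => F x j) (X t) := (continuous_apply j).continuousAt.comp hFt
  obtain ⟨ρ, hρ, hball⟩ := Metric.continuousAt_iff.1 hFj e he
  have hXt : ContinuousAt X t := hcont.continuousAt (Ici_mem_nhds ht)
  obtain ⟨r₀, hr₀, hXball⟩ := Metric.continuousAt_iff.1 hXt ρ hρ
  set r := min (r₀ / 2) (t / 2) with hr
  have hrpos : 0 < r := lt_min (half_pos hr₀) (half_pos ht)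
  have hrt : r ≤ t / 2 := min_le_right _ _
  have hrr₀ : r ≤ r₀ / 2 := min_le_left _ _
  have hnear : ∀ s, 0 ≤ s → dist s t < r₀ → ∀ᶠ k in (U : Filter ℕ), dist (Y k s) (X t) < ρ := by
    intro s hs hst
    have h1 : Tendsto (fun k => Y k s) U (𝓝 (X s)) := tendsto_pi_nhds.2 fun i => hX s i hs
    exact (h1.dist tendsto_const_nhds).eventually (gt_mem_nhds (hXball hst))
  have hlo := hnear (t - r) (by linarith) (by
    rw [Real.dist_eq, sub_sub_cancel_left, abs_neg, abs_of_pos hrpos]; linarith)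
  have hhi := hnear (t + r) (by linarith) (by
    rw [Real.dist_eq, add_sub_cancel_left, abs_of_pos hrpos]; linarith)
  refine ⟨r, hrpos, fun s s' hs hss' hs' => ?_⟩
  have hs0 : 0 ≤ s := by linarith
  have hs0' : 0 ≤ s' := by linarith
  have hfl : ∀ a, 0 ≤ a → Tendsto (fun k => h k * (⌊a / h k⌋₊ : ℝ)) U (𝓝 a) := by
    intro a ha
    have h1 : Tendsto (fun k => a - ε k) U (𝓝 (a - 0)) := tendsto_const_nhds.sub hεlim
    rw [sub_zero] at h1
    refine tendsto_of_tendsto_of_tendsto_of_le_of_le h1 tendsto_const_nhds (fun k => ?_) fun k => ?_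
    · have := (mul_floor_bounds (hh k) ha).2
      simp only
      linarith [hhε k]
    · exact (mul_floor_bounds (hh k) ha).1
  have hd := (hfl s' hs0').sub (hfl s hs0)
  refine le_of_tendsto_of_tendsto
    ((((hX s' j hs0').sub (hX s j hs0)).sub (hd.mul_const (F (X t) j))).abs) (hd.const_mul e) ?_
  filter_upwards [hlo, hhi] with k hk1 hk2
  refine eulerSeq_approx (hh k) (Nat.floor_mono (div_le_div_of_nonneg_right hss' (hh k).le))
    fun l hl1 hl2 => ?_
  -- The scheme is monotone, so closeness at the two times `t - r` and `t + r` confines all iterates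
  -- in between to the ball where the field is nearly constant.
  have hmono := hF.eulerSeq_mono (hh k) (hε k) (hz k) (hzJ k)
  have e1 : Y k (t - r) ≤ eulerSeq F (h k) (z k) l :=
    hmono ((Nat.floor_mono (div_le_div_of_nonneg_right hs (hh k).le)).trans hl1)
  have e2 : eulerSeq F (h k) (z k) l ≤ Y k (t + r) :=
    hmono (hl2.le.trans (Nat.floor_mono (div_le_div_of_nonneg_right hs' (hh k).le)))
  have e3 : dist (eulerSeq F (h k) (z k) l) (X t) < ρ := by
    rw [dist_pi_lt_iff hρ] at hk1 hk2 ⊢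
    intro i
    have a1 := hk1 i
    have a2 := hk2 i
    rw [Real.dist_eq, abs_lt] at a1 a2 ⊢
    exact ⟨by linarith [e1 i], by linarith [e2 i]⟩
  have := hball e3
  rw [Real.dist_eq] at this
  exact this.le

/-! ### Executability of a round -/

section Existence

variable {n d : ℕ} {f : (Fin n → ℝ) → ℝ} {p lam : ℝ} {x' a u : Fin n → ℝ}

/-- The variables of the row `a` which move when the loop is started at `u`. -/
def movingSet (lam : ℝ) (x' a u : Fin n → ℝ) : Set (Fin n) :=
  {j | 0 < a j ∧ (0 < lam ∨ 0 < x' j ∨ 0 < u j ∨ a ⬝ᵥ x' < 1)}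

open Classical in
/-- The state `x` with the variables outside `J` reset to `u`. -/
noncomputable def resetOutside (J : Set (Fin n)) (u x : Fin n → ℝ) : Fin n → ℝ :=
  fun j => if j ∈ J then x j else u j

/-- The growth rates of the variables in `J` while the row `a` is processed, truncated where the
constraint holds. -/
noncomputable def growthField (f : (Fin n → ℝ) → ℝ) (d : ℕ) (lam : ℝ) (x' a u : Fin n → ℝ)
    (x : Fin n → ℝ) (j : Fin n) : ℝ :=
  open Classical in
  if j ∈ movingSet lam x' a u then
    a j * (min (x j) (1 / a j) +
      growthTerm d lam x' a (resetOutside (movingSet lam x' a u) u x) j) /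
      orthantGrad f (resetOutside (movingSet lam x' a u) u fun i => min (x i) (1 / a i)) j
  else 0

theorem resetOutside_mem {J : Set (Fin n)} {x : Fin n → ℝ} {j : Fin n} (hj : j ∈ J) :
    resetOutside J u x j = x j := by simp [resetOutside, hj]

theorem resetOutside_notMem {J : Set (Fin n)} {x : Fin n → ℝ} {j : Fin n} (hj : j ∉ J) :
    resetOutside J u x j = u j := by simp [resetOutside, hj]

theorem resetOutside_eq_self {J : Set (Fin n)} {x : Fin n → ℝ} (h : ∀ j ∉ J, x j = u j) :
    resetOutside J u x = x := by
  ext j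
  by_cases hj : j ∈ J
  · exact resetOutside_mem hj
  · rw [resetOutside_notMem hj, h j hj]

theorem resetOutside_nonneg {J : Set (Fin n)} {x : Fin n → ℝ} (hu : 0 ≤ u)
    (hx : ∀ j ∈ J, 0 ≤ x j) : 0 ≤ resetOutside J u x := by
  intro j
  by_cases hj : j ∈ J
  · rw [resetOutside_mem hj]; exact hx j hj
  · rw [resetOutside_notMem hj]; exact hu j

theorem continuous_resetOutside {J : Set (Fin n)} : Continuous (resetOutside J u) := by
  refine continuous_pi fun j => ?_
  by_cases hj : j ∈ J
  · simp only [resetOutside_mem hj]; exact continuous_apply j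
  · simp only [resetOutside_notMem hj]; exact continuous_const

/-- Each reason for belonging to the moving set gives its own bound: a uniform share, an advice
share while `x_j < x'_j` (and the size of `x_j` afterwards), or a positive initial value. The clamp
at `1 / a j` keeps it positive. -/
theorem exists_pos_le_min_add_growthTerm (hx' : 0 ≤ x') (h0 : 0 ≤ lam) (h1 : lam ≤ 1) (ha : 0 ≤ a)
    (hd : 1 ≤ d) (hu : 0 ≤ u) {j : Fin n} (hj : j ∈ movingSet lam x' a u) :
    ∃ c > 0, ∀ x, u ≤ x → c ≤ min (x j) (1 / a j) + growthTerm d lam x' a x j := by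
  obtain ⟨haj, hj⟩ := hj
  have hd0 : (0 : ℝ) < d := by exact_mod_cast hd
  have hmin : ∀ x : Fin n → ℝ, u ≤ x → 0 ≤ min (x j) (1 / a j) := fun x hx =>
    le_min ((hu j).trans (hx j)) (by positivity)
  by_cases hax : 1 ≤ a ⬝ᵥ x'
  swap
  · refine ⟨1 / (a j * d), by positivity, fun x hx => ?_⟩
    simp only [growthTerm, hax, if_false]
    linarith [hmin x hx]
  rcases h0.lt_or_eq with hl | hl
  · refine ⟨lam / (a j * d), by positivity, fun x hx => ?_⟩
    linarith [hmin x hx, le_growthTerm (d := d) (x := x) hx' h1 ha j]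
  by_cases hxj : 0 < x' j
  · have hax0 : 0 < a ⬝ᵥ x' := zero_lt_one.trans_le hax
    refine ⟨min (x' j / (a ⬝ᵥ x')) (min (x' j) (1 / a j)), by positivity, fun x hx => ?_⟩
    by_cases hlt : x j < x' j
    · have e1 := le_growthTerm_of_advice (d := d) h0 ha hax hlt
      have e2 : x' j / (a ⬝ᵥ x') ≤ (1 - lam) * x' j / (a ⬝ᵥ adviceLeft x' x) := by
        rw [← hl, sub_zero, one_mul]
        have hle : ∀ i, a i * adviceLeft x' x i ≤ a i * x' i := by
          intro i
          refine mul_le_mul_of_nonneg_left ?_ (ha i)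
          unfold adviceLeft
          split_ifs
          exacts [le_rfl, hx' i]
        have hpos : 0 < a ⬝ᵥ adviceLeft x' x := by
          refine lt_of_lt_of_le (mul_pos haj hxj) ?_
          have : a j * x' j = a j * adviceLeft x' x j := by simp [adviceLeft, hlt]
          rw [this]
          exact Finset.single_le_sum (f := fun j => a j * adviceLeft x' x j)
            (fun i _ => mul_nonneg (ha i) (adviceLeft_nonneg hx' i)) (Finset.mem_univ j)
        exact div_le_div_of_nonneg_left hxj.le hpos (Finset.sum_le_sum fun i _ => hle i)
      exact (min_le_left _ _).trans (by linarith [hmin x hx])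
    · push Not at hlt
      refine (min_le_right _ _).trans ?_
      have e1 := min_le_min_right (1 / a j) hlt
      linarith [growthTerm_nonneg (d := d) (x := x) hx' h0 h1 ha j]
  · have huj : 0 < u j := by
      rcases hj with h | h | h | h
      exacts [absurd h hl.not_lt, absurd h hxj, h, absurd h (not_lt.2 hax)]
    refine ⟨min (u j) (1 / a j), by positivity, fun x hx => ?_⟩
    have e1 := min_le_min_right (1 / a j) (hx j)
    linarith [growthTerm_nonneg (d := d) (x := x) hx' h0 h1 ha j]

/-- Clamped states lie below a fixed point `b`, so the gradient in the denominator is at most `∇_j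
f(b)`. If `x_j ≥ η`, it is at least the partial derivative at `min(η, 1/a_j) e_j`, positive since
`j` is not free, while the numerator is at most `2`. -/
theorem exists_isGrowthField (hf : IsCoveringObjective f) (hp : IsGrowthExponent f p)
    (hx' : 0 ≤ x') (h0 : 0 ≤ lam) (h1 : lam ≤ 1) (ha : 0 ≤ a) (hd : 1 ≤ d)
    (hcard : (Finset.univ.filter fun j => 0 < a j).card ≤ d) (hu : 0 ≤ u)
    (hfree : ∀ j, 0 < a j → ¬ IsFree f j) :
    ∃ c, IsGrowthField (growthField f d lam x' a u) u (movingSet lam x' a u) c := by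
  set J := movingSet lam x' a u with hJ
  set b : Fin n → ℝ := resetOutside J u fun i => 1 / a i with hb
  have hb0 : 0 ≤ b := resetOutside_nonneg hu fun j hj => (one_div_pos.2 hj.1).le
  have hbpos : ∀ j ∈ J, 0 < b j := fun j hj => by
    rw [hb, resetOutside_mem hj]; exact one_div_pos.2 hj.1
  have hclamp0 : ∀ x : Fin n → ℝ, (∀ i ∈ J, 0 < x i) →
      0 ≤ resetOutside J u fun i => min (x i) (1 / a i) := fun x hx =>
    resetOutside_nonneg hu fun j hj => (lt_min (hx j hj) (one_div_pos.2 hj.1)).le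
  have hclampb : ∀ x : Fin n → ℝ, (resetOutside J u fun i => min (x i) (1 / a i)) ≤ b := by
    intro x j
    by_cases hj : j ∈ J
    · rw [hb, resetOutside_mem hj, resetOutside_mem hj]; exact min_le_right _ _
    · rw [hb, resetOutside_notMem hj, resetOutside_notMem hj]
  have hgpos : ∀ x : Fin n → ℝ, (∀ i ∈ J, 0 < x i) → ∀ j ∈ J,
      0 < orthantGrad f (resetOutside J u fun i => min (x i) (1 / a i)) j := by
    intro x hx j hj
    refine hf.grad_pos hp (hclamp0 x hx) ?_ (hfree j hj.1)
    rw [resetOutside_mem hj]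
    exact lt_min (hx j hj) (one_div_pos.2 hj.1)
  have hlow : ∀ j, ∃ c > 0, j ∈ J → ∀ x, u ≤ x → (∀ i ∈ J, 0 < x i) →
      c ≤ growthField f d lam x' a u x j := by
    intro j
    by_cases hj : j ∈ J
    swap
    · exact ⟨1, one_pos, fun h => absurd h hj⟩
    obtain ⟨c, hc, hcx⟩ := exists_pos_le_min_add_growthTerm (d := d) hx' h0 h1 ha hd hu hj
    have hL : 0 < orthantGrad f b j := hf.grad_pos hp hb0 (hbpos j hj) (hfree j hj.1)
    have haj : 0 < a j := hj.1
    refine ⟨a j * c / orthantGrad f b j, by positivity, fun _ x hux hx => ?_⟩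
    have hux' : u ≤ resetOutside J u x := by
      intro i
      by_cases hi : i ∈ J
      · rw [resetOutside_mem hi]; exact hux i
      · rw [resetOutside_notMem hi]
    have e1 := hcx _ hux'
    rw [resetOutside_mem hj] at e1
    have e2 := hf.grad_mono (hclamp0 x hx) hb0 (hclampb x) j
    have e3 := hgpos x hx j hj
    unfold growthField
    rw [if_pos hj]
    exact div_le_div₀ (mul_nonneg haj.le (hc.le.trans e1)) (mul_le_mul_of_nonneg_left e1 haj.le)
      e3 e2
  choose c hc0 hc using hlow
  obtain ⟨c₀, hcc, hc₀⟩ : ∃ c₀ : ℝ, (∀ j, c₀ < c j) ∧ 0 < c₀ := by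
    have h2 : ∀ᶠ y in 𝓝[>] (0 : ℝ), ∀ j, y < c j :=
      eventually_all.2 fun j => (gt_mem_nhds (hc0 j)).filter_mono nhdsWithin_le_nhds
    exact (h2.and self_mem_nhdsWithin).exists
  refine ⟨c₀, hu, hc₀, fun x j hj => if_neg hj, fun x hux hx j hj =>
    (hcc j).le.trans (hc j hj x hux hx), fun η hη => ?_⟩
  set q : Fin n → ℝ := fun j => orthantGrad f (Pi.single j (min η (1 / a j))) j with hq
  refine ⟨∑ i, |2 / q i|, fun x hux hx j hj hηj => ?_⟩
  have haj : 0 < a j := hj.1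
  have hm : 0 < min η (1 / a j) := lt_min hη (one_div_pos.2 haj)
  have hs0 : (0 : Fin n → ℝ) ≤ Pi.single j (min η (1 / a j)) := Pi.single_nonneg.2 hm.le
  have hqj : 0 < q j := hf.grad_pos hp hs0 (by simpa using hm) (hfree j haj)
  have e1 : q j ≤ orthantGrad f (resetOutside J u fun i => min (x i) (1 / a i)) j := by
    refine hf.grad_mono hs0 (hclamp0 x hx) (fun i => ?_) j
    by_cases hij : i = j
    · subst hij
      rw [Pi.single_eq_same, resetOutside_mem hj]
      exact min_le_min_right _ hηj
    · rw [Pi.single_eq_of_ne hij]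
      exact hclamp0 x hx i
  have e2 : a j * (min (x j) (1 / a j) + growthTerm d lam x' a (resetOutside J u x) j) ≤ 2 := by
    have s1 := sum_mul_growthTerm_le (d := d) (x := resetOutside J u x) (x' := x') h0 h1 ha hcard
    have s2 := Finset.single_le_sum (f := fun j => a j * growthTerm d lam x' a (resetOutside J u x) j)
      (fun i _ => mul_nonneg (ha i) (growthTerm_nonneg hx' h0 h1 ha i)) (Finset.mem_univ j)
    have s3 : a j * min (x j) (1 / a j) ≤ a j * (1 / a j) :=
      mul_le_mul_of_nonneg_left (min_le_right _ _) haj.le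
    rw [mul_one_div_cancel haj.ne'] at s3
    rw [mul_add]
    linarith
  unfold growthField
  rw [if_pos hj]
  calc _ ≤ 2 / q j := div_le_div₀ zero_le_two e2 hqj e1
    _ ≤ |2 / q j| := le_abs_self _
    _ ≤ _ := Finset.single_le_sum (f := fun i => |2 / q i|) (fun i _ => abs_nonneg _)
      (Finset.mem_univ j)

/-- Away from the thresholds `x_i = x'_i` the set of unreached coordinates is locally constant,
hence so is `D_j`; the denominator is continuous and positive where `x_j > 0`. -/
theorem continuousAt_growthField (hf : IsCoveringObjective f) (hp : IsGrowthExponent f p)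
    (hu : 0 ≤ u) (hfree : ∀ j, 0 < a j → ¬ IsFree f j) {y : Fin n → ℝ}
    (hy : ∀ j ∈ movingSet lam x' a u, 0 < y j) (hyx' : ∀ j ∈ movingSet lam x' a u, y j ≠ x' j) :
    ContinuousAt (growthField f d lam x' a u) y := by
  set J := movingSet lam x' a u with hJ
  refine continuousAt_pi.2 fun j => ?_
  by_cases hj : j ∈ J
  swap
  · have : (fun x => growthField f d lam x' a u x j) = fun _ => 0 := funext fun x => if_neg hj
    rw [this]
    exact continuousAt_const
  have hform : (fun x => growthField f d lam x' a u x j) = fun x =>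
      a j * (min (x j) (1 / a j) + growthTerm d lam x' a (resetOutside J u x) j) /
        orthantGrad f (resetOutside J u fun i => min (x i) (1 / a i)) j :=
    funext fun x => if_pos hj
  rw [hform]
  have hcl : Continuous fun x : Fin n → ℝ => resetOutside J u fun i => min (x i) (1 / a i) :=
    continuous_resetOutside.comp (continuous_pi fun i => (continuous_apply i).min continuous_const)
  have hcl0 : ∀ x : Fin n → ℝ, (∀ i ∈ J, 0 < x i) →
      0 ≤ resetOutside J u fun i => min (x i) (1 / a i) := fun x hx =>
    resetOutside_nonneg hu fun j hj => (lt_min (hx j hj) (one_div_pos.2 hj.1)).le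
  have hclj : 0 < (resetOutside J u fun i => min (y i) (1 / a i)) j := by
    rw [resetOutside_mem hj]
    exact lt_min (hy j hj) (one_div_pos.2 hj.1)
  have hev : ∀ᶠ x in 𝓝 y, ∀ i, i ∈ J → 0 < x i := by
    refine eventually_all.2 fun i => ?_
    by_cases hi : i ∈ J
    · filter_upwards [(continuous_apply i).continuousAt.eventually (lt_mem_nhds (hy i hi))] with x hx
      exact fun _ => hx
    · exact Eventually.of_forall fun x h => absurd h hi
  refine ContinuousAt.div (continuousAt_const.mul (ContinuousAt.add
    ((continuous_apply j).min continuous_const).continuousAt ?_)) ?_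
    (hf.grad_pos hp (hcl0 y hy) hclj (hfree j hj.1)).ne'
  · have hadv : ∀ᶠ x in 𝓝 y, adviceLeft x' (resetOutside J u x) =
        adviceLeft x' (resetOutside J u y) := by
      have : ∀ᶠ x in 𝓝 y, ∀ i, adviceLeft x' (resetOutside J u x) i =
          adviceLeft x' (resetOutside J u y) i := by
        refine eventually_all.2 fun i => ?_
        by_cases hi : i ∈ J
        · simp only [adviceLeft, resetOutside_mem hi]
          rcases (hyx' i hi).lt_or_gt with h | h
          · filter_upwards [(continuous_apply i).continuousAt.eventually (gt_mem_nhds h)] with x hx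
            simp [hx, h]
          · filter_upwards [(continuous_apply i).continuousAt.eventually (lt_mem_nhds h)] with x hx
            simp [hx.not_gt, h.not_gt]
        · simp only [adviceLeft, resetOutside_notMem hi]
          exact Eventually.of_forall fun _ => trivial
      filter_upwards [this] with x hx using funext hx
    refine (continuousAt_const (y := growthTerm d lam x' a (resetOutside J u y) j)).congr ?_
    filter_upwards [hadv] with x hx
    simp only [growthTerm, hx]
  · have h2 := hf.continuousWithinAt_grad (hcl0 y hy) hclj
    exact h2.tendsto.comp (tendsto_nhdsWithin_iff.2
      ⟨hcl.tendsto y, by filter_upwards [hev] with x hx using hcl0 x hx⟩)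

theorem movingSet_nonempty (ha : 0 ≤ a) (hpos : ∃ j, 0 < a j) :
    (movingSet lam x' a u).Nonempty := by
  by_cases h : 0 < lam ∨ a ⬝ᵥ x' < 1
  · obtain ⟨j, hj⟩ := hpos
    rcases h with h | h
    exacts [⟨j, hj, Or.inl h⟩, ⟨j, hj, Or.inr (Or.inr (Or.inr h))⟩]
  · push Not at h
    by_contra hne
    have : a ⬝ᵥ x' ≤ 0 := by
      refine Finset.sum_nonpos fun j _ => ?_
      rcases (ha j).eq_or_lt with h2 | h2
      · simp only [Pi.zero_apply] at h2
        rw [← h2, zero_mul]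
      · refine mul_nonpos_of_nonneg_of_nonpos h2.le ?_
        by_contra hx
        exact hne ⟨j, h2, Or.inr (Or.inl (not_le.1 hx))⟩
    linarith [h.2]

theorem exists_isGrowthPath (hf : IsCoveringObjective f) (hp : IsGrowthExponent f p)
    (hx' : 0 ≤ x') (h0 : 0 ≤ lam) (h1 : lam ≤ 1) (ha : 0 ≤ a) (hd : 1 ≤ d)
    (hcard : (Finset.univ.filter fun j => 0 < a j).card ≤ d) (hu : 0 ≤ u)
    (hpos : ∃ j, 0 < a j) (hau : a ⬝ᵥ u < 1) (hfree : ∀ j, 0 < a j → ¬ IsFree f j) :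
    ∃ T X, IsGrowthPath f d lam x' a u T X := by
  obtain ⟨c, hF⟩ := exists_isGrowthField hf hp hx' h0 h1 ha hd hcard hu hfree
  obtain ⟨X, hX0, hXc, hXout, hXlow, hXd⟩ := hF.exists_path
  set J := movingSet lam x' a u with hJ
  have hXu : ∀ t, 0 ≤ t → ∀ j ∈ J, u j + c * t ≤ X t j := by
    intro t ht j hj
    have := hXlow j hj 0 t le_rfl ht
    rwa [hX0, sub_zero] at this
  have hXnn : ∀ t, 0 ≤ t → 0 ≤ X t := by
    intro t ht j
    by_cases hj : j ∈ J
    · have := hXu t ht j hj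
      have h2 : 0 ≤ u j := hu j
      have h3 := mul_nonneg hF.pos.le ht
      simp only [Pi.zero_apply]
      linarith
    · rw [hXout t j hj]; exact hu j
  have hsingle : ∀ t, 0 ≤ t → ∀ j, a j * X t j ≤ a ⬝ᵥ X t := fun t ht j =>
    Finset.single_le_sum (f := fun j => a j * X t j)
      (fun i _ => mul_nonneg (ha i) (hXnn t ht i)) (Finset.mem_univ j)
  set W : Set ℝ := Ici 0 ∩ {t | 1 ≤ a ⬝ᵥ X t} with hW
  have hWc : IsClosed W := by
    have : ContinuousOn (fun t => a ⬝ᵥ X t) (Ici 0) :=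
      continuousOn_finsetSum _ fun j _ => continuousOn_const.mul
        ((continuous_apply j).comp_continuousOn hXc)
    exact this.preimage_isClosed_of_isClosed isClosed_Ici isClosed_Ici
  have hWne : W.Nonempty := by
    -- One moving coordinate, growing at speed at least `c`, satisfies the row alone by time `1/(a_j
    -- c)`.
    obtain ⟨j, hj⟩ := movingSet_nonempty (u := u) (x' := x') ha hpos
    have haj : 0 < a j := hj.1
    have hcp := hF.pos
    have ht : 0 ≤ 1 / (a j * c) := by positivity
    refine ⟨1 / (a j * c), ht, ?_⟩
    have e1 := mul_le_mul_of_nonneg_left (hXu _ ht j hj) haj.le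
    have e2 : a j * (u j + c * (1 / (a j * c))) = a j * u j + 1 := by field_simp
    have e3 : 0 ≤ a j * u j := mul_nonneg haj.le (hu j)
    rw [e2] at e1
    exact (by linarith : 1 ≤ a j * X (1 / (a j * c)) j).trans (hsingle _ ht j)
  have hWbdd : BddBelow W := ⟨0, fun t ht => ht.1⟩
  set T := sInf W with hT
  have hTW : T ∈ W := hWc.csInf_mem hWne hWbdd
  have hTpos : 0 < T := by
    refine lt_of_le_of_ne hTW.1 fun h => ?_
    have h2 : 1 ≤ a ⬝ᵥ X T := hTW.2
    rw [← h, hX0] at h2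
    linarith
  have hunsat : ∀ τ ∈ Ico 0 T, a ⬝ᵥ X τ < 1 := by
    intro τ hτ
    by_contra hc
    exact notMem_of_lt_csInf hτ.2 hWbdd ⟨hτ.1, not_lt.1 hc⟩
  refine ⟨T, X, hTpos, hX0, hXc.mono Icc_subset_Ici_self, fun τ hτ => hXnn τ hτ.1, hunsat, hTW.2,
    fun τ hτ j hj => hXout τ j fun hjJ => hjJ.1.ne' hj,
    ⋃ j, {t | j ∈ J ∧ 0 ≤ t ∧ X t j = x' j}, finite_iUnion fun j => ?_, ?_⟩
  -- Moving coordinates increase strictly, so each meets its advice value at most once.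
  · refine Set.Subsingleton.finite ?_
    have key : ∀ s t, j ∈ J → 0 ≤ s → X s j = X t j → ¬ s < t := by
      intro s t hj hs hst hlt
      have := hXlow j hj s t hs hlt.le
      have := mul_pos hF.pos (sub_pos.2 hlt)
      linarith
    rintro s ⟨hj, hs, hs'⟩ t ⟨-, ht, ht'⟩
    exact le_antisymm (not_lt.1 (key t s hj ht (by rw [ht', hs'])))
      (not_lt.1 (key s t hj hs (by rw [ht', hs'])))
  · intro τ hτ hτS j haj
    have hτu := hunsat τ ⟨hτ.1.le, hτ.2⟩
    by_cases hj : j ∈ J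
    · have hXpos : ∀ i ∈ J, 0 < X τ i := by
        intro i hi
        have := hXu τ hτ.1.le i hi
        have h2 : 0 ≤ u i := hu i
        have h3 := mul_pos hF.pos hτ.1
        linarith
      refine ⟨_, hXd τ hτ.1 (continuousAt_growthField hf hp hu hfree hXpos fun i hi h => hτS
        (mem_iUnion.2 ⟨i, hi, hτ.1.le, h⟩)) j, ?_⟩
      -- Before the row is satisfied `a_i x_i < 1`, so the truncation in the field is inactive.
      have hmin : ∀ i ∈ J, min (X τ i) (1 / a i) = X τ i := by
        intro i hi
        refine min_eq_left ?_
        rw [le_div_iff₀ hi.1, mul_comm]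
        exact (hsingle τ hτ.1.le i).trans hτu.le
      have e1 : (resetOutside J u fun i => min (X τ i) (1 / a i)) = X τ := by
        ext i
        by_cases hi : i ∈ J
        · rw [resetOutside_mem hi, hmin i hi]
        · rw [resetOutside_notMem hi, hXout τ i hi]
      have e2 : resetOutside J u (X τ) = X τ := resetOutside_eq_self (hXout τ)
      have e3 : growthField f d lam x' a u (X τ) j =
          a j * (X τ j + growthTerm d lam x' a (X τ) j) / orthantGrad f (X τ) j := by
        unfold growthField
        rw [if_pos hj, ← hJ, e1, e2, hmin j hj]
      rw [e3]
      exact mul_div_cancel₀ _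
        (hf.grad_pos hp (hXnn τ hτ.1.le) (hXpos j hj) (hfree j haj)).ne'
    -- A variable of the row that does not move has `x_j = 0` and `D_j = 0`, so the constant path
    -- satisfies its equation.
    · have hnot : ¬ (0 < lam ∨ 0 < x' j ∨ 0 < u j ∨ a ⬝ᵥ x' < 1) := fun h => hj ⟨haj, h⟩
      push Not at hnot
      obtain ⟨hl, hxj, huj, hax⟩ := hnot
      refine ⟨0, ?_, ?_⟩
      · simp only [hXout _ j hj]
        exact hasDerivAt_const _ _
      · have e1 : x' j = 0 := le_antisymm hxj (hx' j)
        have e2 : u j = 0 := le_antisymm huj (hu j)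
        have e3 : lam = 0 := le_antisymm hl h0
        have e4 : adviceLeft x' (X τ) j = 0 := by simp [adviceLeft, e1]
        simp [growthTerm, hax, e4, e3, hXout τ j hj, e2]

theorem exists_PDLARound (hf : IsCoveringObjective f) (hp : IsGrowthExponent f p)
    (hx' : 0 ≤ x') (h0 : 0 ≤ lam) (h1 : lam ≤ 1) (ha : 0 ≤ a) (hd : 1 ≤ d)
    (hcard : (Finset.univ.filter fun j => 0 < a j).card ≤ d) (hu : 0 ≤ u)
    (hpos : ∃ j, 0 < a j) : ∃ v, PDLARound f d lam x' a u v := by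
  classical
  by_cases hau : 1 ≤ a ⬝ᵥ u
  · exact ⟨u, .satisfied hau⟩
  push Not at hau
  by_cases hfree : ∃ j, 0 < a j ∧ IsFree f j
  · obtain ⟨j, haj, hj⟩ := hfree
    have hs : 0 ≤ (1 - a ⬝ᵥ u) / a j := div_nonneg (by linarith) haj.le
    refine ⟨u + Pi.single j ((1 - a ⬝ᵥ u) / a j), .jump hau ⟨j, haj, hj⟩ _
      (le_add_of_nonneg_right (Pi.single_nonneg.2 hs)) (fun i hi => ?_) ?_⟩
    · have hij : i ≠ j := fun h => hi (h ▸ ⟨haj, hj⟩)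
      simp [hij]
    · rw [dotProduct_add, dotProduct_single, mul_div_cancel₀ _ haj.ne']
      ring
  · push Not at hfree
    obtain ⟨T, X, hX⟩ := exists_isGrowthPath hf hp hx' h0 h1 ha hd hcard hu hpos hau hfree
    exact ⟨X T, .grow hau hfree T X hX⟩

end Existence

/-! ### The online algorithm as a fold over the revealed rows -/

section Online

variable {m n d : ℕ} {f : (Fin n → ℝ) → ℝ} {p lam : ℝ} {x' : Fin n → ℝ}
  {A : Matrix (Fin m) (Fin n) ℝ}

open Classical in
/-- A choice of the outcome of one round of the algorithm. -/
noncomputable def pdlaStep (f : (Fin n → ℝ) → ℝ) (d : ℕ) (lam : ℝ) (x' u a : Fin n → ℝ) :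
    Fin n → ℝ :=
  if h : ∃ v, PDLARound f d lam x' a u v then h.choose else u

/-- The online algorithm which processes the rows one after the other. -/
noncomputable def pdlaOnline (f : (Fin n → ℝ) → ℝ) (d : ℕ) (lam : ℝ) (x' : Fin n → ℝ) :
    OnlineAlgorithm n :=
  fun rows => rows.foldl (pdlaStep f d lam x') 0

theorem pdlaOnline_run_succ (i : Fin m) :
    (pdlaOnline f d lam x').run A i.succ =
      pdlaStep f d lam x' ((pdlaOnline f d lam x').run A i.castSucc) (A i) := by
  have h : (List.ofFn fun i => A i).take (i + 1) = (List.ofFn fun i => A i).take i ++ [A i] := by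
    rw [List.take_add_one]
    simp
  simp only [OnlineAlgorithm.run, pdlaOnline, Fin.val_succ, Fin.val_castSucc, h, List.foldl_append,
    List.foldl_cons, List.foldl_nil]

theorem isPDLARun_pdlaOnline (hf : IsCoveringObjective f) (hp : IsGrowthExponent f p)
    (hx' : 0 ≤ x') (h0 : 0 ≤ lam) (h1 : lam ≤ 1) (hA : IsCoveringMatrix A)
    (hd : rowSparsity A = d) : IsPDLARun f d lam x' A ((pdlaOnline f d lam x').run A) := by
  have hstart : (pdlaOnline f d lam x').run A 0 = 0 := by
    simp [OnlineAlgorithm.run, pdlaOnline]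
  have hstep : ∀ i : Fin m, 0 ≤ (pdlaOnline f d lam x').run A i.castSucc →
      PDLARound f d lam x' (A i) ((pdlaOnline f d lam x').run A i.castSucc)
        ((pdlaOnline f d lam x').run A i.succ) := by
    intro i hi
    have hex := exists_PDLARound hf hp hx' h0 h1 (hA.1 i) (one_le_rowSparsity hA hd i)
      (card_pos_le_rowSparsity hd i) hi (exists_pos_of_isCoveringMatrix hA i)
    rw [pdlaOnline_run_succ, pdlaStep, dif_pos hex]
    exact hex.choose_spec
  have hnn : ∀ k : Fin (m + 1), 0 ≤ (pdlaOnline f d lam x').run A k := by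
    intro k
    induction k using Fin.induction with
    | zero => exact hstart.ge
    | succ i ih => exact ih.trans ((hstep i ih).le_and_cover hf hp hx' h0 h1 (hA.1 i)).1
  exact ⟨hstart, fun i => hstep i (hnn _)⟩

end Online

end

theorem theorem4 :
    ∃ (C : ℝ) (K : ℝ → ℝ), 0 < C ∧
      ∀ (n : ℕ) (f : (Fin n → ℝ) → ℝ) (p : ℝ), IsCoveringObjective f → IsGrowthExponent f p →
      ∀ (x' : Fin n → ℝ), 0 ≤ x' → ∀ (lam : ℝ), 0 ≤ lam → lam ≤ 1 → ∀ (d : ℕ),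
        -- the algorithm can be carried out online on all instances of row sparsity `d`
        (∃ alg : OnlineAlgorithm n, ∀ (m : ℕ) (A : Matrix (Fin m) (Fin n) ℝ),
          IsCoveringMatrix A → rowSparsity A = d → IsPDLARun f d lam x' A (alg.run A)) ∧
        -- and each of its executions is feasible, monotone, consistent and robust
        (∀ (m : ℕ) (A : Matrix (Fin m) (Fin n) ℝ), IsCoveringMatrix A → rowSparsity A = d →
          ∀ x : Fin (m + 1) → Fin n → ℝ, IsPDLARun f d lam x' A x →
            Monotone x ∧
            (∀ i : Fin m, 1 ≤ A i ⬝ᵥ x i.succ) ∧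
            IsCover A (x (Fin.last m)) ∧
            (lam < 1 → f (x (Fin.last m)) ≤
              K p / (1 - lam) * f x' +
                (C * (p * Real.log (max (d : ℝ) 2))) ^ p * coveringOPT f A) ∧
            (0 < lam → f (x (Fin.last m)) ≤
              (C * (p * Real.log (max (d : ℝ) 2 / lam))) ^ p * coveringOPT f A) ∧
            (lam < 1 → IsCover A x' → f (x (Fin.last m)) ≤ K p / (1 - lam) * f x')) := by
  refine ⟨64, adviceLoss, by norm_num, fun n f p hf hp x' hx' lam h0 h1 d =>
    ⟨⟨pdlaOnline f d lam x', fun m A hA hd => isPDLARun_pdlaOnline hf hp hx' h0 h1 hA hd⟩,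
      fun m A hA hd x hx => ?_⟩⟩
  have hmono := hx.monotone hf hp hx' h0 h1 hA
  have hcov : ∀ i : Fin m, 1 ≤ A i ⬝ᵥ x i.succ := fun i =>
    ((hx.2 i).le_and_cover hf hp hx' h0 h1 (hA.1 i)).2
  refine ⟨hmono, hcov, ⟨hx.nonneg hf hp hx' h0 h1 hA _, fun i => (hcov i).trans ?_⟩,
    hx.bounds hf hp hx' h0 h1 hA hd⟩
  exact dotProduct_le_dotProduct_of_nonneg_left (hmono (Fin.le_last _)) (hA.1 i)
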